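/- All vector spaces are over $\mathbb C$. A \emph{braiding} on $V$ is an automorphism $\beta$ of $V\otimes V$ with $(\beta\otimes\mathrm{id})(\mathrm{id}\otimes\beta)(\beta\otimes\mathrm{id})=(\mathrm{id}\otimes\beta)(\beta\otimes\mathrm{id})(\mathrm{id}\otimes\beta)$. Put $\beta_{1,0}=\beta_{0,1}=\mathrm{id}_V$, $\beta_{1,1}=\beta$, $\beta_{1,2}=(\mathrm{id}\otimes\beta)(\beta\otimes\mathrm{id})$, $\beta_{2,1}=(\beta\otimes\mathrm{id})(\mathrm{id}\otimes\beta)$. A linear map $f:V^{\otimes m}\to V^{\otimes n}$ is \emph{$\beta$-compatible} if $(f\otimes\mathrm{id})\beta_{1,m}=\beta_{1,n}(\mathrm{id}\otimes f)$ and $(\mathrm{id}\otimes f)\beta_{m,1}=\beta_{n,1}(f\otimes\mathrm{id})$. A \emph{braided algebra} (\emph{braided coalgebra}) is a unital associative algebra (a coalgebra) with a braiding $\beta$ such that multiplication and unit (comultiplication and counit) are $\beta$-compatible. A \emph{braided bialgebra} $(\mathcal B,\Delta,\delta,\mu,\mathbf 1,\beta)$ is a braided algebra and a braided coalgebra with $\Delta\circ\mu=(\mu\otimes\mu)(\mathrm{id}\otimes\beta\otimes\mathrm{id})(\Delta\otimes\Delta)$,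 $\delta\circ\mu=\delta\otimes\delta$, $\Delta(\mathbf 1)=\mathbf 1\otimes\mathbf 1$, $\delta(\mathbf 1)=1$. It is a \emph{braided $*$-bialgebra} if $(\mathcal B,\mu,\mathbf 1)$ is a $*$-algebra and $\mathcal B\otimes\mathcal B$, with multiplication $(\mu\otimes\mu)(\mathrm{id}\otimes\beta\otimes\mathrm{id})$, carries an involution making it a $*$-algebra such that $a\mapsto a\otimes\mathbf 1$, $a\mapsto\mathbf 1\otimes a$ and $\Delta$ are $*$-homomorphisms. The space $\mathcal B\otimes\mathcal B$ is a coalgebra with comultiplication $\Lambda=(\mathrm{id}\otimes\beta\otimes\mathrm{id})(\Delta\otimes\Delta)$ and counit $\delta\otimes\delta$. The convolution of maps on $\mathcal B\otimes\mathcal B$ is $f\star g=(f\otimes g)\circ\Lambda$ if at least one of $f,g$ is a linear functional (identifying $\mathbb C\otimes W=W=W\otimes\mathbb C$), and for a linear functional $\psi$ on $\mathcal B\otimes\mathcal B$ one writes $e_\star^{\psi}(c)=\sum_{n\ge 0}\psi^{\star n}(c)/n!$ with $\psi^{\star 0}=\delta\otimes\delta$. An \emph{additive deformation} of $\mathcal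 B$ is a family $(\mu_t)_{t\in\mathbb R}$ of $\beta$-compatible linear maps $\mathcal B\otimes\mathcal B\to\mathcal B$ such that $\mu_0=\mu$; $(\mathcal B,\mu_t,\mathbf 1,\beta)$ is a braided algebra for every $t$; $\Delta\circ\mu_{t+s}=(\mu_t\otimes\mu_s)\circ\Lambda$ for all $t,s\in\mathbb R$; and $\delta\circ\mu_t\to\delta\circ\mu_0$ pointwise as $t\to 0$. If $\mathcal B$ is a braided $*$-bialgebra, it is an \emph{additive $*$-deformation} if in addition $\mu_t(a^*\otimes b^*)=\mu_t(b\otimes a)^*$ for all $t,a,b$. \textbf{Theorem.} Let $\mathcal B$ be a braided bialgebra. (A) Let $(\mu_t)_{t\in\mathbb R}$ be an additive deformation of $\mathcal B$. Then the pointwise derivative $L=\frac{d}{dt}\,\delta\circ\mu_t\big|_{t=0}$ exists and is a $\beta$-compatible linear functional $L:\mathcal B\otimes\mathcal B\to\mathbb C$, and (i) $\mu_t=\mu\star e_\star^{tL}$ for all $t\in\mathbb R$, where the series defining $e_\star^{tL}$ converges pointwise; (ii) $L\star\mu=\mu\star L$; (iii) $L(\mathbf 1\otimes\mathbf 1)=0$;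 (iv) $\partial L:=\delta\otimes L-L\circ(\mu\otimes\mathrm{id})+L\circ(\mathrm{id}\otimes\mu)-L\otimes\delta=0$. If $\mathcal B$ is a braided $*$-bialgebra and $(\mu_t)$ an additive $*$-deformation, then also (v) $\overline{L(a\otimes b)}=L(b^*\otimes a^*)$ for all $a,b\in\mathcal B$. (B) Conversely, let $L:\mathcal B\otimes\mathcal B\to\mathbb C$ be a $\beta$-compatible linear functional satisfying (ii)--(iv). Then the series $e_\star^{tL}$ converges pointwise for every $t\in\mathbb R$ and $\mu_t:=\mu\star e_\star^{tL}$ defines an additive deformation of $\mathcal B$. If $\mathcal B$ is a braided $*$-bialgebra and $L$ also satisfies (v), then $(\mu_t)$ is an additive $*$-deformation. -/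

import Mathlib

open scoped TensorProduct ComplexConjugate Topology Nat
open Filter

noncomputable section

namespace BraidedDeformation

section Braiding

variable {V : Type*} [AddCommGroup V] [Module ℂ V]

/-- `β ⊗ id` on `V ⊗ V ⊗ V`. -/
def braidFst (β : V ⊗[ℂ] V ≃ₗ[ℂ] V ⊗[ℂ] V) :
    (V ⊗[ℂ] V) ⊗[ℂ] V →ₗ[ℂ] (V ⊗[ℂ] V) ⊗[ℂ] V :=
  TensorProduct.map β.toLinearMap LinearMap.id

/-- `id ⊗ β` on `V ⊗ V ⊗ V`. -/
def braidSnd (β : V ⊗[ℂ] V ≃ₗ[ℂ] V ⊗[ℂ] V) :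
    (V ⊗[ℂ] V) ⊗[ℂ] V →ₗ[ℂ] (V ⊗[ℂ] V) ⊗[ℂ] V :=
  (TensorProduct.assoc ℂ V V V).symm.toLinearMap ∘ₗ
    TensorProduct.map LinearMap.id β.toLinearMap ∘ₗ (TensorProduct.assoc ℂ V V V).toLinearMap

/-- `β` is a braiding: it satisfies the braid equation. -/
def IsBraiding (β : V ⊗[ℂ] V ≃ₗ[ℂ] V ⊗[ℂ] V) : Prop :=
  braidFst β ∘ₗ braidSnd β ∘ₗ braidFst β = braidSnd β ∘ₗ braidFst β ∘ₗ braidSnd β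

/-- `β_{1,0} : V ⊗ ℂ → ℂ ⊗ V`, the canonical identification. -/
def braid10 : V ⊗[ℂ] ℂ →ₗ[ℂ] ℂ ⊗[ℂ] V := (TensorProduct.comm ℂ V ℂ).toLinearMap

/-- `β_{0,1} : ℂ ⊗ V → V ⊗ ℂ`, the canonical identification. -/
def braid01 : ℂ ⊗[ℂ] V →ₗ[ℂ] V ⊗[ℂ] ℂ := (TensorProduct.comm ℂ ℂ V).toLinearMap

/-- `β_{1,2} = (id ⊗ β) ∘ (β ⊗ id) : V ⊗ V² → V² ⊗ V`. -/
def braid12 (β : V ⊗[ℂ] V ≃ₗ[ℂ] V ⊗[ℂ] V) :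
    V ⊗[ℂ] (V ⊗[ℂ] V) →ₗ[ℂ] (V ⊗[ℂ] V) ⊗[ℂ] V :=
  braidSnd β ∘ₗ braidFst β ∘ₗ (TensorProduct.assoc ℂ V V V).symm.toLinearMap

/-- `β_{2,1} = (β ⊗ id) ∘ (id ⊗ β) : V² ⊗ V → V ⊗ V²`. -/
def braid21 (β : V ⊗[ℂ] V ≃ₗ[ℂ] V ⊗[ℂ] V) :
    (V ⊗[ℂ] V) ⊗[ℂ] V →ₗ[ℂ] V ⊗[ℂ] (V ⊗[ℂ] V) :=
  (TensorProduct.assoc ℂ V V V).toLinearMap ∘ₗ braidFst β ∘ₗ braidSnd β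

/-- A linear map `f : M → N` is compatible with given crossings `V ⊗ M → M ⊗ V`, `M ⊗ V → V ⊗ M`
and likewise for `N`. It is used for `M`, `N` among `ℂ = V⁰`, `V = V¹`, `V ⊗ V = V²` with crossings
`β_{1,m}` and `β_{m,1}`; then the two conditions are `β`-invariance and `β⁻¹`-invariance, and
together they are `β`-compatibility. -/
structure IsCompatible {M N : Type*} [AddCommGroup M] [Module ℂ M] [AddCommGroup N] [Module ℂ N]
    (overM : V ⊗[ℂ] M →ₗ[ℂ] M ⊗[ℂ] V) (overN : V ⊗[ℂ] N →ₗ[ℂ] N ⊗[ℂ] V)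
    (underM : M ⊗[ℂ] V →ₗ[ℂ] V ⊗[ℂ] M) (underN : N ⊗[ℂ] V →ₗ[ℂ] V ⊗[ℂ] N)
    (f : M →ₗ[ℂ] N) : Prop where
  /-- `(f ⊗ id) ∘ β_{1,m} = β_{1,n} ∘ (id ⊗ f)` -/
  invariant : TensorProduct.map f LinearMap.id ∘ₗ overM = overN ∘ₗ TensorProduct.map LinearMap.id f
  /-- `(id ⊗ f) ∘ β_{m,1} = β_{n,1} ∘ (f ⊗ id)` -/
  inv_invariant :
    TensorProduct.map LinearMap.id f ∘ₗ underM = underN ∘ₗ TensorProduct.map f LinearMap.id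

/-- `β`-compatibility of a multiplication `V² → V`. -/
def MulCompatible (β : V ⊗[ℂ] V ≃ₗ[ℂ] V ⊗[ℂ] V) (m : V ⊗[ℂ] V →ₗ[ℂ] V) : Prop :=
  IsCompatible (braid12 β) β.toLinearMap (braid21 β) β.toLinearMap m

/-- `β`-compatibility of a unit, as the linear map `V⁰ = ℂ → V`, `z ↦ z e`. -/
def UnitCompatible (β : V ⊗[ℂ] V ≃ₗ[ℂ] V ⊗[ℂ] V) (e : V) : Prop :=
  IsCompatible braid10 β.toLinearMap braid01 β.toLinearMap (LinearMap.toSpanSingleton ℂ V e)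

/-- `β`-compatibility of a comultiplication `V → V²`. -/
def ComulCompatible (β : V ⊗[ℂ] V ≃ₗ[ℂ] V ⊗[ℂ] V) (D : V →ₗ[ℂ] V ⊗[ℂ] V) : Prop :=
  IsCompatible β.toLinearMap (braid12 β) β.toLinearMap (braid21 β) D

/-- `β`-compatibility of a linear functional `V → ℂ`. -/
def CounitCompatible (β : V ⊗[ℂ] V ≃ₗ[ℂ] V ⊗[ℂ] V) (f : V →ₗ[ℂ] ℂ) : Prop :=
  IsCompatible β.toLinearMap braid10 β.toLinearMap braid01 f

/-- `β`-compatibility of a linear functional `V² → ℂ`. -/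
def FormCompatible (β : V ⊗[ℂ] V ≃ₗ[ℂ] V ⊗[ℂ] V) (L : V ⊗[ℂ] V →ₗ[ℂ] ℂ) : Prop :=
  IsCompatible (braid12 β) braid10 (braid21 β) braid01 L

/-- `id ⊗ β ⊗ id` on `V ⊗ V ⊗ V ⊗ V`. -/
def braidMid (β : V ⊗[ℂ] V ≃ₗ[ℂ] V ⊗[ℂ] V) :
    (V ⊗[ℂ] V) ⊗[ℂ] (V ⊗[ℂ] V) →ₗ[ℂ] (V ⊗[ℂ] V) ⊗[ℂ] (V ⊗[ℂ] V) :=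
  (TensorProduct.assoc ℂ V V (V ⊗[ℂ] V)).symm.toLinearMap ∘ₗ
    TensorProduct.map LinearMap.id
      ((TensorProduct.assoc ℂ V V V).toLinearMap ∘ₗ braidFst β ∘ₗ
        (TensorProduct.assoc ℂ V V V).symm.toLinearMap) ∘ₗ
    (TensorProduct.assoc ℂ V V (V ⊗[ℂ] V)).toLinearMap

/-- `(V, m, e, β)` is a braided algebra: `(V, m, e)` is a unital associative algebra, `β` is a
braiding, and `m` and `e` are `β`-compatible. -/
structure IsBraidedAlgebra (β : V ⊗[ℂ] V ≃ₗ[ℂ] V ⊗[ℂ] V) (m : V ⊗[ℂ] V →ₗ[ℂ] V) (e : V) :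
    Prop where
  braiding : IsBraiding β
  assoc : ∀ a b c : V, m (m (a ⊗ₜ[ℂ] b) ⊗ₜ[ℂ] c) = m (a ⊗ₜ[ℂ] m (b ⊗ₜ[ℂ] c))
  one_mul : ∀ a : V, m (e ⊗ₜ[ℂ] a) = a
  mul_one : ∀ a : V, m (a ⊗ₜ[ℂ] e) = a
  mul_compatible : MulCompatible β m
  unit_compatible : UnitCompatible β e

/-- A coalgebra with a braiding for which `Δ` and `δ` are compatible. -/
structure IsBraidedCoalgebra [Coalgebra ℂ V] (β : V ⊗[ℂ] V ≃ₗ[ℂ] V ⊗[ℂ] V) : Prop where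
  braiding : IsBraiding β
  comul_compatible : ComulCompatible β (Coalgebra.comul (R := ℂ) (A := V))
  counit_compatible : CounitCompatible β (Coalgebra.counit (R := ℂ) (A := V))

/-- `Λ = (id ⊗ β ⊗ id) ∘ (Δ ⊗ Δ)`, the comultiplication of `V ⊗ V`. -/
def tensorComul [Coalgebra ℂ V] (β : V ⊗[ℂ] V ≃ₗ[ℂ] V ⊗[ℂ] V) :
    V ⊗[ℂ] V →ₗ[ℂ] (V ⊗[ℂ] V) ⊗[ℂ] (V ⊗[ℂ] V) :=
  braidMid β ∘ₗ TensorProduct.map Coalgebra.comul Coalgebra.comul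

/-- `δ ⊗ δ`, the counit of `V ⊗ V`. -/
def tensorCounit (V : Type*) [AddCommGroup V] [Module ℂ V] [Coalgebra ℂ V] : V ⊗[ℂ] V →ₗ[ℂ] ℂ :=
  (TensorProduct.lid ℂ ℂ).toLinearMap ∘ₗ TensorProduct.map Coalgebra.counit Coalgebra.counit

end Braiding

section Convolution

variable {C : Type*} [AddCommGroup C] [Module ℂ C]

/-- The convolution `m ∘ (f ⊗ g) ∘ D` of `f : C → P` and `g : C → Q`, where `m : P ⊗ Q → R` is the
relevant product. If `P` or `Q` is `ℂ` then `m` is the canonical identification `ℂ ⊗ R = R` or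
`R ⊗ ℂ = R`. -/
def conv {P Q R : Type*} [AddCommGroup P] [Module ℂ P] [AddCommGroup Q] [Module ℂ Q]
    [AddCommGroup R] [Module ℂ R] (m : P ⊗[ℂ] Q ≃ₗ[ℂ] R) (D : C →ₗ[ℂ] C ⊗[ℂ] C)
    (f : C →ₗ[ℂ] P) (g : C →ₗ[ℂ] Q) : C →ₗ[ℂ] R :=
  m.toLinearMap ∘ₗ TensorProduct.map f g ∘ₗ D

/-- Convolution powers of a linear functional on a coalgebra `(C, D, ε)`. -/
def convPow (D : C →ₗ[ℂ] C ⊗[ℂ] C) (ε ψ : C →ₗ[ℂ] ℂ) : ℕ → (C →ₗ[ℂ] ℂ)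
  | 0 => ε
  | n + 1 => conv (TensorProduct.lid ℂ ℂ) D (convPow D ε ψ n) ψ

/-- `E` is the convolution exponential of `ψ`: for every `c` the series `∑ ψ^{⋆n}(c) / n!` converges
and its sum is `E c`. -/
def IsConvExp (D : C →ₗ[ℂ] C ⊗[ℂ] C) (ε ψ E : C →ₗ[ℂ] ℂ) : Prop :=
  ∀ c : C, HasSum (fun n : ℕ => convPow D ε ψ n c / (n ! : ℂ)) (E c)

end Convolution

section Bialgebra

variable {B : Type*} [Ring B] [Algebra ℂ B]

/-- The multiplication `M = (μ ⊗ μ) ∘ (id ⊗ β ⊗ id)` of `B ⊗ B`. -/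
def tensorMul (β : B ⊗[ℂ] B ≃ₗ[ℂ] B ⊗[ℂ] B) :
    (B ⊗[ℂ] B) ⊗[ℂ] (B ⊗[ℂ] B) →ₗ[ℂ] B ⊗[ℂ] B :=
  TensorProduct.map (LinearMap.mul' ℂ B) (LinearMap.mul' ℂ B) ∘ₗ braidMid β

variable [Coalgebra ℂ B]

/-- The algebra and coalgebra `B` together with `β` form a braided bialgebra. -/
structure IsBraidedBialgebra (β : B ⊗[ℂ] B ≃ₗ[ℂ] B ⊗[ℂ] B) : Prop where
  algebra : IsBraidedAlgebra β (LinearMap.mul' ℂ B) 1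
  coalgebra : IsBraidedCoalgebra β
  comul_mul : Coalgebra.comul (R := ℂ) (A := B) ∘ₗ LinearMap.mul' ℂ B =
    tensorMul β ∘ₗ TensorProduct.map Coalgebra.comul Coalgebra.comul
  comul_one : Coalgebra.comul (R := ℂ) (1 : B) = 1 ⊗ₜ[ℂ] 1
  counit_mul : Coalgebra.counit (R := ℂ) (A := B) ∘ₗ LinearMap.mul' ℂ B = tensorCounit B
  counit_one : Coalgebra.counit (R := ℂ) (1 : B) = 1

/-- A braided bialgebra which is a `*`-algebra and for which `B ⊗ B`, with multiplication `M`, has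
an antilinear antimultiplicative involution that makes the two embeddings `B → B ⊗ B` and `Δ`
`*`-homomorphisms. -/
structure IsBraidedStarBialgebra [StarRing B] [StarModule ℂ B]
    (β : B ⊗[ℂ] B ≃ₗ[ℂ] B ⊗[ℂ] B) : Prop where
  bialgebra : IsBraidedBialgebra β
  exists_star : ∃ J : B ⊗[ℂ] B →ₗ⋆[ℂ] B ⊗[ℂ] B,
    (∀ x, J (J x) = x) ∧
    (∀ x y, J (tensorMul β (x ⊗ₜ[ℂ] y)) = tensorMul β (J y ⊗ₜ[ℂ] J x)) ∧
    (∀ a : B, J (a ⊗ₜ[ℂ] 1) = star a ⊗ₜ[ℂ] 1) ∧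
    (∀ a : B, J (1 ⊗ₜ[ℂ] a) = 1 ⊗ₜ[ℂ] star a) ∧
    (∀ a : B, J (Coalgebra.comul (R := ℂ) a) = Coalgebra.comul (R := ℂ) (star a))

/-- Additive deformations of the braided bialgebra `B`. -/
structure IsAdditiveDeformation (β : B ⊗[ℂ] B ≃ₗ[ℂ] B ⊗[ℂ] B) (μ : ℝ → (B ⊗[ℂ] B →ₗ[ℂ] B)) :
    Prop where
  zero : μ 0 = LinearMap.mul' ℂ B
  algebra : ∀ t, IsBraidedAlgebra β (μ t) 1
  comul : ∀ t s, Coalgebra.comul (R := ℂ) (A := B) ∘ₗ μ (t + s) =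
    TensorProduct.map (μ t) (μ s) ∘ₗ tensorComul β
  counit : ∀ x, Tendsto (fun t => Coalgebra.counit (R := ℂ) (μ t x)) (𝓝 0)
    (𝓝 (Coalgebra.counit (R := ℂ) (μ 0 x)))

/-- Additive `*`-deformations. -/
structure IsAdditiveStarDeformation [StarRing B] (β : B ⊗[ℂ] B ≃ₗ[ℂ] B ⊗[ℂ] B)
    (μ : ℝ → (B ⊗[ℂ] B →ₗ[ℂ] B)) : Prop extends IsAdditiveDeformation β μ where
  star_mul : ∀ t, ∀ a b : B, μ t (star a ⊗ₜ[ℂ] star b) = star (μ t (b ⊗ₜ[ℂ] a))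

/-- `∂L = δ ⊗ L - L ∘ (μ ⊗ id) + L ∘ (id ⊗ μ) - L ⊗ δ`. -/
def coboundary (L : B ⊗[ℂ] B →ₗ[ℂ] ℂ) : (B ⊗[ℂ] B) ⊗[ℂ] B →ₗ[ℂ] ℂ :=
  (TensorProduct.lid ℂ ℂ).toLinearMap ∘ₗ TensorProduct.map Coalgebra.counit L ∘ₗ
      (TensorProduct.assoc ℂ B B B).toLinearMap
    - L ∘ₗ TensorProduct.map (LinearMap.mul' ℂ B) LinearMap.id
    + L ∘ₗ TensorProduct.map LinearMap.id (LinearMap.mul' ℂ B) ∘ₗ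
      (TensorProduct.assoc ℂ B B B).toLinearMap
    - (TensorProduct.lid ℂ ℂ).toLinearMap ∘ₗ TensorProduct.map L Coalgebra.counit

/-- `E = e_⋆^{tL}` on the coalgebra `(B ⊗ B, Λ, δ ⊗ δ)`. -/
def IsFormExp (β : B ⊗[ℂ] B ≃ₗ[ℂ] B ⊗[ℂ] B) (L : B ⊗[ℂ] B →ₗ[ℂ] ℂ) (t : ℝ)
    (E : B ⊗[ℂ] B →ₗ[ℂ] ℂ) : Prop :=
  IsConvExp (tensorComul β) (tensorCounit B) ((t : ℂ) • L) E

/-- `μ ⋆ K` for a functional `K` on `B ⊗ B`. -/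
def mulConv (β : B ⊗[ℂ] B ≃ₗ[ℂ] B ⊗[ℂ] B) (K : B ⊗[ℂ] B →ₗ[ℂ] ℂ) : B ⊗[ℂ] B →ₗ[ℂ] B :=
  conv (TensorProduct.rid ℂ B) (tensorComul β) (LinearMap.mul' ℂ B) K

/-- `K ⋆ μ` for a functional `K` on `B ⊗ B`. -/
def convMul (β : B ⊗[ℂ] B ≃ₗ[ℂ] B ⊗[ℂ] B) (K : B ⊗[ℂ] B →ₗ[ℂ] ℂ) : B ⊗[ℂ] B →ₗ[ℂ] B :=
  conv (TensorProduct.lid ℂ B) (tensorComul β) K (LinearMap.mul' ℂ B)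

/-- `conj (L (a ⊗ b)) = L (b* ⊗ a*)`. -/
def HermitianForm [StarRing B] (L : B ⊗[ℂ] B →ₗ[ℂ] ℂ) : Prop :=
  ∀ a b : B, conj (L (a ⊗ₜ[ℂ] b)) = L (star b ⊗ₜ[ℂ] star a)

end Bialgebra

end BraidedDeformation

end

open BraidedDeformation

/-!
An additive deformation is recovered from its functionals `F_t = δ ∘ μ_t`: applying `δ` to one leg of
`Δ ∘ μ_{t+s} = (μ_t ⊗ μ_s) ∘ Λ` gives `μ_t = μ ⋆ F_t = F_t ⋆ μ`, and applying it to both legs gives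
`F_{t+s} = F_t ⋆ F_s`. So the theorem is about one-parameter convolution groups of functionals on the
coalgebra `(B ⊗ B, Λ, δ ⊗ δ)`.

*Analysis.* Every element of a coalgebra is a linear combination of matrix coefficients of a
finite-dimensional comodule (`IsCoalg.exists_isCoeffMatrix`). A functional evaluated on such a matrix
is a complex matrix, and convolution becomes matrix multiplication. Convergence of convolution
exponentials, `e^f ⋆ e^g = e^(f+g)` for commuting `f`, `g`, and the existence of the generator of a
pointwise continuous convolution group (`IsCoalg.exists_generator`) thus reduce to the matrix
exponential and to `exists_eq_exp_of_continuousAt`. For an additive deformation the properties of `L`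
follow by differentiating the corresponding properties of `μ_t` at `0`.

*Braids.* That `Λ` is coassociative and `β`-compatible, and that `B ⊗ B ⊗ B` is again a coalgebra, are
identities of string diagrams. They are proved in an arbitrary monoidal category, where the
associators are handled by the tactic `monoidal`, and transported along a monoidal structure on complex
vector spaces.

*Cocycles give associative products.* Let `L` be a commuting cocycle, and let `D` be the
comultiplication of `B ⊗ B ⊗ B`. The maps `μ ⊗ id`, `id ⊗ μ`, `id ⊗ id ⊗ δ` and `δ ⊗ id ⊗ id` are
coalgebra homomorphisms to `B ⊗ B`, so that the functionals `L ∘ (μ ⊗ id)`, `L ⊗ δ`, `L ∘ (id ⊗ μ)`,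
`δ ⊗ L` have as exponentials the same expressions in `e^{tL}`. As `L` commutes with `μ`, the first two
commute under convolution, and so do the last two; the cocycle condition says that the two sums agree.
Hence `e^{tL} ∘ (μ ⊗ id) ⋆ (e^{tL} ⊗ δ) = e^{tL} ∘ (id ⊗ μ) ⋆ (δ ⊗ e^{tL})`, which is the
associativity of `μ ⋆ e^{tL}` (`IsBraidedBialgebra.mulConv_assoc`).

*Involutions.* The involution of `B ⊗ B` is necessarily `a ⊗ b ↦ β (b* ⊗ a*)`. A functional that can
be pulled through `β` does not notice the extra crossing, so conjugation along `a ⊗ b ↦ b* ⊗ a*` maps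
convolution powers of `L` to convolution powers of its conjugate
(`IsBraidedStarBialgebra.actR_flipStar`).
-/

/-! ### Crossings and twisted comultiplications in a monoidal category -/

namespace CategoryTheory.MonoidalCategory

universe v u
variable {𝒞 : Type u} [Category.{v} 𝒞] [MonoidalCategory 𝒞]

/-- The exchange of the two middle factors of `(X ⊗ X') ⊗ (Y ⊗ Y')` along `σ : X' ⊗ Y ⟶ Y ⊗ X'`. -/
def midSwap (X : 𝒞) {X' Y : 𝒞} (Y' : 𝒞) (σ : X' ⊗ Y ⟶ Y ⊗ X') :
    (X ⊗ X') ⊗ (Y ⊗ Y') ⟶ (X ⊗ Y) ⊗ (X' ⊗ Y') :=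
  (α_ X X' (Y ⊗ Y')).hom ≫
    X ◁ ((α_ X' Y Y').inv ≫ σ ▷ Y' ≫ (α_ Y X' Y').hom) ≫ (α_ X Y (X' ⊗ Y')).inv

/-- The comultiplication of `X ⊗ Y` built from comultiplications of the factors and a crossing. -/
def crossComul {X Y : 𝒞} (σ : X ⊗ Y ⟶ Y ⊗ X) (DX : X ⟶ X ⊗ X) (DY : Y ⟶ Y ⊗ Y) :
    X ⊗ Y ⟶ (X ⊗ Y) ⊗ (X ⊗ Y) :=
  (DX ⊗ₘ DY) ≫ midSwap X Y σ

/-- `DY` slides through `σ : X ⊗ Y ⟶ Y ⊗ X`: comultiplying after the crossing is the same as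
comultiplying first and moving `X` past both copies of `Y`. -/
def SlidesRight {X Y : 𝒞} (σ : X ⊗ Y ⟶ Y ⊗ X) (DY : Y ⟶ Y ⊗ Y) : Prop :=
  σ ≫ DY ▷ X = X ◁ DY ≫ (α_ _ _ _).inv ≫ σ ▷ Y ≫ (α_ _ _ _).hom ≫ Y ◁ σ ≫ (α_ _ _ _).inv

/-- The counterpart of `SlidesRight` for a comultiplication of the left factor. -/
def SlidesLeft {X Y : 𝒞} (σ : X ⊗ Y ⟶ Y ⊗ X) (DX : X ⟶ X ⊗ X) : Prop :=
  σ ≫ Y ◁ DX = DX ▷ Y ≫ (α_ _ _ _).hom ≫ X ◁ σ ≫ (α_ _ _ _).inv ≫ σ ▷ X ≫ (α_ _ _ _).hom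

/-- If both comultiplications slide through the crossing, the twisted comultiplication of `X ⊗ Y` is
coassociative. -/
theorem crossComul_coassoc {X Y : 𝒞} (σ : X ⊗ Y ⟶ Y ⊗ X) (DX : X ⟶ X ⊗ X) (DY : Y ⟶ Y ⊗ Y)
    (hX : DX ≫ DX ▷ X ≫ (α_ X X X).hom = DX ≫ X ◁ DX)
    (hY : DY ≫ DY ▷ Y ≫ (α_ Y Y Y).hom = DY ≫ Y ◁ DY)
    (h₁ : SlidesRight σ DY) (h₂ : SlidesLeft σ DX) :
    crossComul σ DX DY ≫ crossComul σ DX DY ▷ (X ⊗ Y) ≫ (α_ _ _ _).hom =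
      crossComul σ DX DY ≫ (X ⊗ Y) ◁ crossComul σ DX DY := by
  simp only [SlidesRight, SlidesLeft] at h₁ h₂
  simp only [crossComul, midSwap, tensorHom_def]
  calc
    _ = 𝟙 _ ⊗≫ DX ▷ Y ⊗≫ (X ◁ (X ◁ DY ⊗≫ σ ▷ Y ⊗≫ 𝟙 (Y ⊗ X ⊗ Y)) ≫ DX ▷ (Y ⊗ X ⊗ Y)) ⊗≫
        (X ⊗ X) ◁ (DY ▷ X) ▷ Y ⊗≫ X ◁ σ ▷ (Y ⊗ X ⊗ Y) ⊗≫ 𝟙 _ := by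
      monoidal
    _ = 𝟙 _ ⊗≫ DX ▷ Y ⊗≫ DX ▷ (X ⊗ Y) ⊗≫ (X ⊗ X ⊗ X) ◁ DY ⊗≫ (X ⊗ X) ◁ (σ ≫ DY ▷ X) ▷ Y ⊗≫
        X ◁ σ ▷ (Y ⊗ X ⊗ Y) ⊗≫ 𝟙 _ := by
      rw [whisker_exchange]; monoidal
    _ = 𝟙 _ ⊗≫ (DX ≫ DX ▷ X ≫ (α_ X X X).hom) ▷ Y ⊗≫
        (X ⊗ X ⊗ X) ◁ (DY ≫ DY ▷ Y ≫ (α_ Y Y Y).hom) ⊗≫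
        (X ⊗ X) ◁ σ ▷ (Y ⊗ Y) ⊗≫ X ◁ ((X ⊗ Y) ◁ (σ ▷ Y) ≫ σ ▷ ((Y ⊗ X) ⊗ Y)) ⊗≫ 𝟙 _ := by
      rw [h₁]; monoidal
    _ = 𝟙 _ ⊗≫ DX ▷ Y ⊗≫ X ◁ (DX ▷ Y ≫ (X ⊗ X) ◁ (DY ≫ Y ◁ DY)) ⊗≫
        (X ⊗ X) ◁ σ ▷ (Y ⊗ Y) ⊗≫ X ◁ σ ▷ (X ⊗ Y ⊗ Y) ⊗≫ (X ⊗ Y ⊗ X) ◁ (σ ▷ Y) ⊗≫ 𝟙 _ := by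
      rw [hX, hY, whisker_exchange]; monoidal
    _ = 𝟙 _ ⊗≫ DX ▷ Y ⊗≫ X ◁ (X ◁ (DY ≫ Y ◁ DY) ≫ DX ▷ (Y ⊗ Y ⊗ Y)) ⊗≫
        (X ⊗ X) ◁ σ ▷ (Y ⊗ Y) ⊗≫ X ◁ σ ▷ (X ⊗ Y ⊗ Y) ⊗≫ (X ⊗ Y ⊗ X) ◁ (σ ▷ Y) ⊗≫ 𝟙 _ := by
      rw [whisker_exchange]
    _ = 𝟙 _ ⊗≫ DX ▷ Y ⊗≫ X ◁ X ◁ DY ⊗≫ ((X ⊗ X ⊗ Y) ◁ DY ≫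
        (X ◁ (DX ▷ Y ≫ (α_ _ _ _).hom ≫ X ◁ σ ≫ (α_ _ _ _).inv ≫ σ ▷ X ≫ (α_ _ _ _).hom)) ▷
          (Y ⊗ Y)) ⊗≫ (X ⊗ Y ⊗ X) ◁ (σ ▷ Y) ⊗≫ 𝟙 _ := by
      monoidal
    _ = 𝟙 _ ⊗≫ DX ▷ Y ⊗≫ X ◁ X ◁ DY ⊗≫ ((X ◁ (σ ≫ Y ◁ DX)) ▷ Y ≫
        (X ⊗ Y ⊗ X ⊗ X) ◁ DY) ⊗≫ (X ⊗ Y ⊗ X) ◁ (σ ▷ Y) ⊗≫ 𝟙 _ := by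
      rw [h₂, whisker_exchange]
    _ = _ := by
      monoidal

/-- If `D` slides (on the right) through `σ` and `τ`, it slides through the crossing of `W ⊗ X`. -/
theorem slidesRight_tensor {W X Y : 𝒞} {σ : X ⊗ Y ⟶ Y ⊗ X} {τ : W ⊗ Y ⟶ Y ⊗ W} {D : Y ⟶ Y ⊗ Y}
    (hσ : SlidesRight σ D) (hτ : SlidesRight τ D) :
    SlidesRight ((α_ W X Y).hom ≫ W ◁ σ ≫ (α_ _ _ _).inv ≫ τ ▷ X ≫ (α_ _ _ _).hom) D := by
  simp only [SlidesRight] at *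
  calc
    _ = 𝟙 _ ⊗≫ W ◁ σ ⊗≫ (τ ≫ D ▷ W) ▷ X ⊗≫ 𝟙 _ := by monoidal
    _ = 𝟙 _ ⊗≫ W ◁ (σ ≫ D ▷ X) ⊗≫ τ ▷ (Y ⊗ X) ⊗≫ Y ◁ τ ▷ X ⊗≫ 𝟙 _ := by
      rw [hτ]; monoidal
    _ = 𝟙 _ ⊗≫ W ◁ X ◁ D ⊗≫ W ◁ σ ▷ Y ⊗≫ ((W ⊗ Y) ◁ σ ≫ τ ▷ (Y ⊗ X)) ⊗≫
        Y ◁ τ ▷ X ⊗≫ 𝟙 _ := by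
      rw [hσ]; monoidal
    _ = _ := by
      rw [whisker_exchange]; monoidal

/-- If the crossings satisfy a Yang–Baxter relation, `crossComul σ DX DY` slides (as the right
factor) through the crossing of `W` with `X ⊗ Y`. -/
theorem slidesRight_crossComul {W X Y : 𝒞} {σ : X ⊗ Y ⟶ Y ⊗ X} {a : W ⊗ X ⟶ X ⊗ W}
    {b : W ⊗ Y ⟶ Y ⊗ W} {DX : X ⟶ X ⊗ X} {DY : Y ⟶ Y ⊗ Y}
    (ha : SlidesRight a DX) (hb : SlidesRight b DY)
    (yb : a ▷ Y ≫ (α_ _ _ _).hom ≫ X ◁ b ≫ (α_ _ _ _).inv ≫ σ ▷ W =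
      (α_ _ _ _).hom ≫ W ◁ σ ≫ (α_ _ _ _).inv ≫ b ▷ X ≫ (α_ _ _ _).hom ≫ Y ◁ a ≫ (α_ _ _ _).inv) :
    SlidesRight ((α_ W X Y).inv ≫ a ▷ Y ≫ (α_ _ _ _).hom ≫ X ◁ b ≫ (α_ _ _ _).inv)
      (crossComul σ DX DY) := by
  simp only [SlidesRight, crossComul, midSwap, tensorHom_def] at *
  calc
    _ = 𝟙 _ ⊗≫ a ▷ Y ⊗≫ (X ◁ b ≫ DX ▷ (Y ⊗ W)) ⊗≫ (X ⊗ X) ◁ DY ▷ W ⊗≫ X ◁ σ ▷ (Y ⊗ W) ⊗≫ 𝟙 _ := by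
      monoidal
    _ = 𝟙 _ ⊗≫ (a ≫ DX ▷ W) ▷ Y ⊗≫ (X ⊗ X) ◁ (b ≫ DY ▷ W) ⊗≫ X ◁ σ ▷ (Y ⊗ W) ⊗≫ 𝟙 _ := by
      rw [whisker_exchange]; monoidal
    _ = 𝟙 _ ⊗≫ W ◁ DX ▷ Y ⊗≫ a ▷ (X ⊗ Y) ⊗≫ X ◁ (a ▷ Y ≫ (X ⊗ W) ◁ DY) ⊗≫
        (X ⊗ X) ◁ b ▷ Y ⊗≫ X ◁ ((X ⊗ Y) ◁ b ≫ σ ▷ (Y ⊗ W)) ⊗≫ 𝟙 _ := by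
      rw [ha, hb]; monoidal
    _ = 𝟙 _ ⊗≫ W ◁ DX ▷ Y ⊗≫ (a ▷ (X ⊗ Y) ≫ (X ⊗ W) ◁ X ◁ DY) ⊗≫
        X ◁ (a ▷ Y ≫ (α_ _ _ _).hom ≫ X ◁ b ≫ (α_ _ _ _).inv ≫ σ ▷ W) ▷ Y ⊗≫
        (X ⊗ Y ⊗ X) ◁ b ⊗≫ 𝟙 _ := by
      rw [← whisker_exchange, whisker_exchange σ b]; monoidal
    _ = 𝟙 _ ⊗≫ W ◁ DX ▷ Y ⊗≫ W ◁ X ◁ X ◁ DY ⊗≫ (a ▷ (X ⊗ Y) ≫ (X ⊗ W) ◁ σ) ▷ Y ⊗≫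
        X ◁ b ▷ (X ⊗ Y) ⊗≫ (X ⊗ Y) ◁ a ▷ Y ⊗≫ (X ⊗ Y ⊗ X) ◁ b ⊗≫ 𝟙 _ := by
      rw [← whisker_exchange, yb]; monoidal
    _ = _ := by
      rw [← whisker_exchange]; monoidal

/-- The counterpart of `slidesRight_crossComul` for the crossing of `X ⊗ Y` with `Z`. -/
theorem slidesLeft_crossComul {X Y Z : 𝒞} {σ : X ⊗ Y ⟶ Y ⊗ X} {a : X ⊗ Z ⟶ Z ⊗ X}
    {b : Y ⊗ Z ⟶ Z ⊗ Y} {DX : X ⟶ X ⊗ X} {DY : Y ⟶ Y ⊗ Y}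
    (ha : SlidesLeft a DX) (hb : SlidesLeft b DY)
    (yb : (α_ _ _ _).hom ≫ X ◁ b ≫ (α_ _ _ _).inv ≫ a ▷ Y ≫ (α_ _ _ _).hom ≫ Z ◁ σ ≫
        (α_ _ _ _).inv =
      σ ▷ Z ≫ (α_ _ _ _).hom ≫ Y ◁ a ≫ (α_ _ _ _).inv ≫ b ▷ X) :
    SlidesLeft ((α_ X Y Z).hom ≫ X ◁ b ≫ (α_ _ _ _).inv ≫ a ▷ Y ≫ (α_ _ _ _).hom)
      (crossComul σ DX DY) := by
  simp only [SlidesLeft, crossComul, midSwap, tensorHom_def] at *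
  calc
    _ = 𝟙 _ ⊗≫ X ◁ b ⊗≫ (a ≫ Z ◁ DX) ▷ Y ⊗≫ Z ◁ (X ⊗ X) ◁ DY ⊗≫
        Z ◁ X ◁ σ ▷ Y ⊗≫ 𝟙 _ := by
      monoidal
    _ = 𝟙 _ ⊗≫ (X ◁ b ≫ DX ▷ (Z ⊗ Y)) ⊗≫ X ◁ a ▷ Y ⊗≫ (a ▷ (X ⊗ Y) ≫ (Z ⊗ X) ◁ X ◁ DY) ⊗≫
        Z ◁ X ◁ σ ▷ Y ⊗≫ 𝟙 _ := by
      rw [ha]; monoidal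
    _ = 𝟙 _ ⊗≫ DX ▷ (Y ⊗ Z) ⊗≫ (X ⊗ X) ◁ b ⊗≫ X ◁ (a ▷ Y ≫ (Z ⊗ X) ◁ DY) ⊗≫ a ▷ (X ⊗ Y ⊗ Y) ⊗≫
        Z ◁ X ◁ σ ▷ Y ⊗≫ 𝟙 _ := by
      rw [whisker_exchange, ← whisker_exchange a]; monoidal
    _ = 𝟙 _ ⊗≫ DX ▷ (Y ⊗ Z) ⊗≫ (X ⊗ X) ◁ (b ≫ Z ◁ DY) ⊗≫ X ◁ a ▷ (Y ⊗ Y) ⊗≫ (a ▷ (X ⊗ Y) ≫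
        (Z ⊗ X) ◁ σ) ▷ Y ⊗≫ 𝟙 _ := by
      rw [← whisker_exchange]; monoidal
    _ = 𝟙 _ ⊗≫ DX ▷ (Y ⊗ Z) ⊗≫ (X ⊗ X) ◁ DY ▷ Z ⊗≫ (X ⊗ X ⊗ Y) ◁ b ⊗≫
        X ◁ ((α_ _ _ _).hom ≫ X ◁ b ≫ (α_ _ _ _).inv ≫ a ▷ Y ≫ (α_ _ _ _).hom ≫ Z ◁ σ ≫
          (α_ _ _ _).inv) ▷ Y ⊗≫ a ▷ (Y ⊗ X ⊗ Y) ⊗≫ 𝟙 _ := by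
      rw [hb, ← whisker_exchange]; monoidal
    _ = 𝟙 _ ⊗≫ DX ▷ (Y ⊗ Z) ⊗≫ (X ⊗ X) ◁ DY ▷ Z ⊗≫ X ◁ ((X ⊗ Y) ◁ b ≫ σ ▷ (Z ⊗ Y)) ⊗≫
        X ◁ Y ◁ a ▷ Y ⊗≫ X ◁ b ▷ (X ⊗ Y) ⊗≫ a ▷ (Y ⊗ X ⊗ Y) ⊗≫ 𝟙 _ := by
      rw [yb]; monoidal
    _ = _ := by
      rw [whisker_exchange]; monoidal

/-- The associator is compatible with iterated `crossComul`. -/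
theorem crossComul_associator {X Y Z : 𝒞} (σ : X ⊗ Y ⟶ Y ⊗ X) (a : X ⊗ Z ⟶ Z ⊗ X)
    (b : Y ⊗ Z ⟶ Z ⊗ Y) (DX : X ⟶ X ⊗ X) (DY : Y ⟶ Y ⊗ Y) (DZ : Z ⟶ Z ⊗ Z) :
    (α_ X Y Z).hom ≫ crossComul ((α_ X Y Z).inv ≫ σ ▷ Z ≫ (α_ _ _ _).hom ≫ Y ◁ a ≫ (α_ _ _ _).inv)
        DX (crossComul b DY DZ) =
      crossComul ((α_ X Y Z).hom ≫ X ◁ b ≫ (α_ _ _ _).inv ≫ a ▷ Y ≫ (α_ _ _ _).hom)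
        (crossComul σ DX DY) DZ ≫ ((α_ X Y Z).hom ⊗ₘ (α_ X Y Z).hom) := by
  simp only [crossComul, midSwap, tensorHom_def]
  calc
    _ = 𝟙 _ ⊗≫ DX ▷ (Y ⊗ Z) ⊗≫ (X ⊗ X) ◁ DY ▷ Z ⊗≫ (X ⊗ X ⊗ Y ⊗ Y) ◁ DZ ⊗≫
        X ◁ ((X ⊗ Y) ◁ (b ▷ Z) ≫ σ ▷ ((Z ⊗ Y) ⊗ Z)) ⊗≫ X ◁ Y ◁ a ▷ (Y ⊗ Z) ⊗≫ 𝟙 _ := by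
      monoidal
    _ = 𝟙 _ ⊗≫ DX ▷ (Y ⊗ Z) ⊗≫ (X ⊗ X) ◁ DY ▷ Z ⊗≫ X ◁ ((X ⊗ Y) ◁ (Y ◁ DZ) ≫ σ ▷ (Y ⊗ Z ⊗ Z)) ⊗≫
        (X ⊗ Y ⊗ X) ◁ (b ▷ Z) ⊗≫ X ◁ Y ◁ a ▷ (Y ⊗ Z) ⊗≫ 𝟙 _ := by
      rw [whisker_exchange]; monoidal
    _ = _ := by
      rw [whisker_exchange]; monoidal

/-- The crossing of two copies of `X ⊗ X`, obtained by moving `X ⊗ X` past `X` twice. -/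
theorem midSwap_midSwap {X : 𝒞} (σ : X ⊗ X ⟶ X ⊗ X) :
    midSwap X X σ ≫ (σ ⊗ₘ σ) ≫ midSwap X X σ =
      (α_ (X ⊗ X) X X).inv ≫
        ((α_ X X X).hom ≫ X ◁ σ ≫ (α_ _ _ _).inv ≫ σ ▷ X ≫ (α_ _ _ _).hom) ▷ X ≫
          (α_ X (X ⊗ X) X).hom ≫
            X ◁ ((α_ X X X).hom ≫ X ◁ σ ≫ (α_ _ _ _).inv ≫ σ ▷ X ≫ (α_ _ _ _).hom) ≫
              (α_ X X (X ⊗ X)).inv := by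
  simp only [midSwap, tensorHom_def]
  monoidal

end CategoryTheory.MonoidalCategory

/-! ### Crossings of complex vector spaces -/

namespace BraidedDeformation

universe u

/-- Complex vector spaces in an arbitrary universe, with linear maps as morphisms. -/
structure CVect : Type (u + 1) where
  /-- the underlying type -/
  carrier : Type u
  [grp : AddCommGroup carrier]
  [mod : Module ℂ carrier]

attribute [instance] CVect.grp CVect.mod

namespace CVect

open CategoryTheory MonoidalCategory

instance : Category CVect.{u} where
  Hom X Y := X.carrier →ₗ[ℂ] Y.carrier
  id _ := LinearMap.id
  comp f g := g ∘ₗ f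

/-- The tensor product, with unit `ULift ℂ` so that it lives in the right universe. -/
instance : MonoidalCategoryStruct CVect.{u} where
  tensorObj X Y := ⟨X.carrier ⊗[ℂ] Y.carrier⟩
  whiskerLeft X _ _ f := TensorProduct.map (LinearMap.id : X.carrier →ₗ[ℂ] X.carrier) f
  whiskerRight f Y := TensorProduct.map f (LinearMap.id : Y.carrier →ₗ[ℂ] Y.carrier)
  tensorHom f g := TensorProduct.map f g
  tensorUnit := ⟨ULift.{u} ℂ⟩
  associator X Y Z :=
    { hom := (TensorProduct.assoc ℂ X.carrier Y.carrier Z.carrier).toLinearMap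
      inv := (TensorProduct.assoc ℂ X.carrier Y.carrier Z.carrier).symm.toLinearMap
      hom_inv_id := LinearEquiv.symm_comp _
      inv_hom_id := LinearEquiv.comp_symm _ }
  leftUnitor X :=
    let e := TensorProduct.congr ULift.moduleEquiv (LinearEquiv.refl ℂ X.carrier) ≪≫ₗ
      TensorProduct.lid ℂ X.carrier
    { hom := e.toLinearMap
      inv := e.symm.toLinearMap
      hom_inv_id := LinearEquiv.symm_comp _
      inv_hom_id := LinearEquiv.comp_symm _ }
  rightUnitor X :=
    let e := TensorProduct.congr (LinearEquiv.refl ℂ X.carrier) ULift.moduleEquiv ≪≫ₗ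
      TensorProduct.rid ℂ X.carrier
    { hom := e.toLinearMap
      inv := e.symm.toLinearMap
      hom_inv_id := LinearEquiv.symm_comp _
      inv_hom_id := LinearEquiv.comp_symm _ }

instance : MonoidalCategory CVect.{u} :=
  MonoidalCategory.ofTensorHom
    (id_tensorHom_id := fun _ _ => TensorProduct.map_id)
    (tensorHom_comp_tensorHom := fun _ _ _ _ => (TensorProduct.map_comp _ _ _ _).symm)
    (associator_naturality := fun _ _ _ => TensorProduct.ext_threefold fun _ _ _ => rfl)
    (leftUnitor_naturality := fun {X Y} f => TensorProduct.ext' fun c x =>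
      (f.map_smul c.down x).symm)
    (rightUnitor_naturality := fun {X Y} f => TensorProduct.ext' fun x c =>
      (f.map_smul c.down x).symm)
    (pentagon := fun _ _ _ _ => TensorProduct.ext_fourfold fun _ _ _ _ => rfl)
    (triangle := fun X Y => TensorProduct.ext_threefold fun x c y => by
      exact (TensorProduct.smul_tmul c.down x y).symm)

end CVect

section Crossing

variable {V W X Y Z : Type u} [AddCommGroup V] [Module ℂ V] [AddCommGroup W] [Module ℂ W]
  [AddCommGroup X] [Module ℂ X] [AddCommGroup Y] [Module ℂ Y] [AddCommGroup Z] [Module ℂ Z]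

/-- The exchange of the two middle factors of `(W ⊗ X) ⊗ (Y ⊗ Z)` along `σ : X ⊗ Y → Y ⊗ X`. For `σ = β`
it is definitionally `braidMid β`. -/
def midMap (σ : X ⊗[ℂ] Y →ₗ[ℂ] Y ⊗[ℂ] X) :
    (W ⊗[ℂ] X) ⊗[ℂ] (Y ⊗[ℂ] Z) →ₗ[ℂ] (W ⊗[ℂ] Y) ⊗[ℂ] (X ⊗[ℂ] Z) :=
  (TensorProduct.assoc ℂ W Y (X ⊗[ℂ] Z)).symm.toLinearMap ∘ₗ
    TensorProduct.map LinearMap.id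
      ((TensorProduct.assoc ℂ Y X Z).toLinearMap ∘ₗ TensorProduct.map σ LinearMap.id ∘ₗ
        (TensorProduct.assoc ℂ X Y Z).symm.toLinearMap) ∘ₗ
    (TensorProduct.assoc ℂ W X (Y ⊗[ℂ] Z)).toLinearMap

/-- The comultiplication `(id ⊗ σ ⊗ id) ∘ (DX ⊗ DY)` of `X ⊗ Y`. For `σ = β` and `DX = DY = Δ` it is
definitionally `tensorComul β`. -/
def twistComul (σ : X ⊗[ℂ] Y →ₗ[ℂ] Y ⊗[ℂ] X) (DX : X →ₗ[ℂ] X ⊗[ℂ] X) (DY : Y →ₗ[ℂ] Y ⊗[ℂ] Y) :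
    X ⊗[ℂ] Y →ₗ[ℂ] (X ⊗[ℂ] Y) ⊗[ℂ] (X ⊗[ℂ] Y) :=
  midMap σ ∘ₗ TensorProduct.map DX DY

/-- The crossing of `X` with `Y ⊗ Z` made of crossings of `X` with `Y` and with `Z`. -/
def crossRight (σ : X ⊗[ℂ] Y →ₗ[ℂ] Y ⊗[ℂ] X) (τ : X ⊗[ℂ] Z →ₗ[ℂ] Z ⊗[ℂ] X) :
    X ⊗[ℂ] (Y ⊗[ℂ] Z) →ₗ[ℂ] (Y ⊗[ℂ] Z) ⊗[ℂ] X :=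
  (TensorProduct.assoc ℂ Y Z X).symm.toLinearMap ∘ₗ TensorProduct.map LinearMap.id τ ∘ₗ
    (TensorProduct.assoc ℂ Y X Z).toLinearMap ∘ₗ TensorProduct.map σ LinearMap.id ∘ₗ
      (TensorProduct.assoc ℂ X Y Z).symm.toLinearMap

/-- The crossing of `X ⊗ Y` with `Z` made of crossings of `X` and of `Y` with `Z`. -/
def crossLeft (σ : X ⊗[ℂ] Z →ₗ[ℂ] Z ⊗[ℂ] X) (τ : Y ⊗[ℂ] Z →ₗ[ℂ] Z ⊗[ℂ] Y) :
    (X ⊗[ℂ] Y) ⊗[ℂ] Z →ₗ[ℂ] Z ⊗[ℂ] (X ⊗[ℂ] Y) :=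
  (TensorProduct.assoc ℂ Z X Y).toLinearMap ∘ₗ TensorProduct.map σ LinearMap.id ∘ₗ
    (TensorProduct.assoc ℂ X Z Y).symm.toLinearMap ∘ₗ TensorProduct.map LinearMap.id τ ∘ₗ
      (TensorProduct.assoc ℂ X Y Z).toLinearMap

/-- The comultiplication `D` of `Y` can be pulled through the crossing `σ : X ⊗ Y → Y ⊗ X`. -/
def ComulOver (σ : X ⊗[ℂ] Y →ₗ[ℂ] Y ⊗[ℂ] X) (D : Y →ₗ[ℂ] Y ⊗[ℂ] Y) : Prop :=
  TensorProduct.map D LinearMap.id ∘ₗ σ = crossRight σ σ ∘ₗ TensorProduct.map LinearMap.id D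

/-- The comultiplication `D` of `X` can be pulled through the crossing `σ : X ⊗ Y → Y ⊗ X`. -/
def ComulUnder (σ : X ⊗[ℂ] Y →ₗ[ℂ] Y ⊗[ℂ] X) (D : X →ₗ[ℂ] X ⊗[ℂ] X) : Prop :=
  TensorProduct.map LinearMap.id D ∘ₗ σ = crossLeft σ σ ∘ₗ TensorProduct.map D LinearMap.id

/-- `D` is coassociative. -/
def Coassoc (D : X →ₗ[ℂ] X ⊗[ℂ] X) : Prop :=
  (TensorProduct.assoc ℂ X X X).toLinearMap ∘ₗ TensorProduct.map D LinearMap.id ∘ₗ D =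
    TensorProduct.map LinearMap.id D ∘ₗ D

theorem Coassoc.twistComul {σ : X ⊗[ℂ] Y →ₗ[ℂ] Y ⊗[ℂ] X} {DX : X →ₗ[ℂ] X ⊗[ℂ] X}
    {DY : Y →ₗ[ℂ] Y ⊗[ℂ] Y} (hX : Coassoc DX) (hY : Coassoc DY) (h₁ : ComulOver σ DY)
    (h₂ : ComulUnder σ DX) : Coassoc (twistComul σ DX DY) :=
  CategoryTheory.MonoidalCategory.crossComul_coassoc (𝒞 := CVect.{u}) (X := ⟨X⟩) (Y := ⟨Y⟩)
    σ DX DY hX hY h₁ h₂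

theorem ComulOver.crossLeft {σ : X ⊗[ℂ] Y →ₗ[ℂ] Y ⊗[ℂ] X} {τ : W ⊗[ℂ] Y →ₗ[ℂ] Y ⊗[ℂ] W}
    {D : Y →ₗ[ℂ] Y ⊗[ℂ] Y} (hσ : ComulOver σ D) (hτ : ComulOver τ D) :
    ComulOver (crossLeft τ σ) D :=
  CategoryTheory.MonoidalCategory.slidesRight_tensor (𝒞 := CVect.{u}) (W := ⟨W⟩) (X := ⟨X⟩)
    (Y := ⟨Y⟩) hσ hτ

variable {β : V ⊗[ℂ] V ≃ₗ[ℂ] V ⊗[ℂ] V} {D : V →ₗ[ℂ] V ⊗[ℂ] V}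

/-- The braid equation lets `Λ` be pulled through `β_{1,2}`. -/
theorem IsBraiding.comulOver_twistComul (hβ : IsBraiding β) (h : ComulOver β.toLinearMap D) :
    ComulOver (braid12 β) (twistComul β.toLinearMap D D) :=
  CategoryTheory.MonoidalCategory.slidesRight_crossComul (𝒞 := CVect.{u}) (W := ⟨V⟩) (X := ⟨V⟩)
    (Y := ⟨V⟩) (σ := β.toLinearMap) (a := β.toLinearMap) (b := β.toLinearMap) h h hβ

/-- The braid equation lets `Λ` be pulled through `β_{2,1}`. -/
theorem IsBraiding.comulUnder_twistComul (hβ : IsBraiding β) (h : ComulUnder β.toLinearMap D) :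
    ComulUnder (braid21 β) (twistComul β.toLinearMap D D) :=
  CategoryTheory.MonoidalCategory.slidesLeft_crossComul (𝒞 := CVect.{u}) (X := ⟨V⟩) (Y := ⟨V⟩)
    (Z := ⟨V⟩) (σ := β.toLinearMap) (a := β.toLinearMap) (b := β.toLinearMap) h h
    hβ.symm

/-- The two bracketings of `V ⊗ V ⊗ V` carry the same twisted comultiplication. -/
theorem twistComul_assoc (β : V ⊗[ℂ] V ≃ₗ[ℂ] V ⊗[ℂ] V) (D : V →ₗ[ℂ] V ⊗[ℂ] V) :
    twistComul (braid12 β) D (twistComul β.toLinearMap D D) ∘ₗ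
        (TensorProduct.assoc ℂ V V V).toLinearMap =
      TensorProduct.map (TensorProduct.assoc ℂ V V V).toLinearMap
          (TensorProduct.assoc ℂ V V V).toLinearMap ∘ₗ
        twistComul (braid21 β) (twistComul β.toLinearMap D D) D :=
  CategoryTheory.MonoidalCategory.crossComul_associator (𝒞 := CVect.{u}) (X := ⟨V⟩) (Y := ⟨V⟩)
    (Z := ⟨V⟩) β.toLinearMap β.toLinearMap β.toLinearMap D D D

/-- Braiding two copies of `V ⊗ V` with one another takes four crossings, grouped here as two moves of
`V ⊗ V` past `V`. -/
theorem midMap_map_midMap (β : V ⊗[ℂ] V ≃ₗ[ℂ] V ⊗[ℂ] V) :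
    midMap β.toLinearMap ∘ₗ TensorProduct.map β.toLinearMap β.toLinearMap ∘ₗ
      midMap β.toLinearMap = crossRight (braid21 β) (braid21 β) :=
  CategoryTheory.MonoidalCategory.midSwap_midSwap (𝒞 := CVect.{u}) (X := ⟨V⟩) β.toLinearMap

end Crossing

/-! ### Functionals passing through crossings -/

section Functionals


variable {C W X Y Z : Type u} [AddCommGroup C] [Module ℂ C] [AddCommGroup W] [Module ℂ W]
  [AddCommGroup X] [Module ℂ X] [AddCommGroup Y] [Module ℂ Y] [AddCommGroup Z] [Module ℂ Z]

/-- The functional `x ⊗ y ↦ f x * g y`. -/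
def prodForm (f : X →ₗ[ℂ] ℂ) (g : Y →ₗ[ℂ] ℂ) : X ⊗[ℂ] Y →ₗ[ℂ] ℂ :=
  (TensorProduct.lid ℂ ℂ).toLinearMap ∘ₗ TensorProduct.map f g

@[simp]
theorem prodForm_tmul (f : X →ₗ[ℂ] ℂ) (g : Y →ₗ[ℂ] ℂ) (x : X) (y : Y) :
    prodForm f g (x ⊗ₜ y) = f x * g y := rfl

/-- Contraction of the first factor with a functional. -/
def contrL (f : X →ₗ[ℂ] ℂ) : X ⊗[ℂ] Y →ₗ[ℂ] Y :=
  (TensorProduct.lid ℂ Y).toLinearMap ∘ₗ TensorProduct.map f LinearMap.id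

/-- Contraction of the second factor with a functional. -/
def contrR (g : Y →ₗ[ℂ] ℂ) : X ⊗[ℂ] Y →ₗ[ℂ] X :=
  (TensorProduct.rid ℂ X).toLinearMap ∘ₗ TensorProduct.map LinearMap.id g

@[simp]
theorem contrL_tmul (f : X →ₗ[ℂ] ℂ) (x : X) (y : Y) : contrL f (x ⊗ₜ[ℂ] y) = f x • y := rfl

@[simp]
theorem contrR_tmul (g : Y →ₗ[ℂ] ℂ) (x : X) (y : Y) : contrR g (x ⊗ₜ[ℂ] y) = g y • x := rfl

theorem apply_contrL (f : X →ₗ[ℂ] ℂ) (g : Y →ₗ[ℂ] ℂ) (z : X ⊗[ℂ] Y) :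
    g (contrL f z) = prodForm f g z := by
  suffices h : g ∘ₗ contrL f = prodForm f g from LinearMap.congr_fun h z
  ext x y
  simp

theorem apply_contrR (f : X →ₗ[ℂ] ℂ) (g : Y →ₗ[ℂ] ℂ) (z : X ⊗[ℂ] Y) :
    f (contrR g z) = prodForm f g z := by
  suffices h : f ∘ₗ contrR g = prodForm f g from LinearMap.congr_fun h z
  ext x y
  simp [mul_comm]

theorem contrL_map (f : X →ₗ[ℂ] ℂ) (p : W →ₗ[ℂ] X) (q : Y →ₗ[ℂ] Z) :
    contrL f ∘ₗ TensorProduct.map p q = q ∘ₗ contrL (f ∘ₗ p) := by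
  ext w y
  simp

theorem contrR_map (g : Y →ₗ[ℂ] ℂ) (p : W →ₗ[ℂ] X) (q : Z →ₗ[ℂ] Y) :
    contrR g ∘ₗ TensorProduct.map p q = p ∘ₗ contrR (g ∘ₗ q) := by
  ext w y
  simp

/-- `g` can be pulled through the crossing `σ : X ⊗ Y → Y ⊗ X`. -/
def OverInv (σ : X ⊗[ℂ] Y →ₗ[ℂ] Y ⊗[ℂ] X) (g : Y →ₗ[ℂ] ℂ) : Prop :=
  contrL g ∘ₗ σ = contrR g

/-- `f` can be pulled through the crossing `σ : X ⊗ Y → Y ⊗ X`. -/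
def UnderInv (σ : X ⊗[ℂ] Y →ₗ[ℂ] Y ⊗[ℂ] X) (f : X →ₗ[ℂ] ℂ) : Prop :=
  contrR f ∘ₗ σ = contrL f

theorem OverInv.apply {σ : X ⊗[ℂ] Y →ₗ[ℂ] Y ⊗[ℂ] X} {g : Y →ₗ[ℂ] ℂ} (h : OverInv σ g) (x : X)
    (y : Y) : contrL g (σ (x ⊗ₜ y)) = g y • x :=
  LinearMap.congr_fun h (x ⊗ₜ y)

theorem UnderInv.apply {σ : X ⊗[ℂ] Y →ₗ[ℂ] Y ⊗[ℂ] X} {f : X →ₗ[ℂ] ℂ} (h : UnderInv σ f) (x : X)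
    (y : Y) : contrR f (σ (x ⊗ₜ y)) = f x • y :=
  LinearMap.congr_fun h (x ⊗ₜ y)

/-- The condition `OverInv σ g` as a family of linear equations between values of `g`. Hence it passes to
pointwise limits, sums of series and derivatives. -/
theorem overInv_iff {σ : X ⊗[ℂ] Y →ₗ[ℂ] Y ⊗[ℂ] X} {g : Y →ₗ[ℂ] ℂ} :
    OverInv σ g ↔ ∀ (χ : X →ₗ[ℂ] ℂ) (z : X ⊗[ℂ] Y), g (contrR χ (σ z)) = g (contrL χ z) := by
  have key (χ : X →ₗ[ℂ] ℂ) (z : X ⊗[ℂ] Y) :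
      (g (contrR χ (σ z)) = g (contrL χ z)) ↔ χ (contrL g (σ z)) = χ (contrR g z) := by
    rw [apply_contrR, apply_contrL, apply_contrL, apply_contrR]
  simp only [key]
  exact ⟨fun h χ z => congrArg χ (LinearMap.congr_fun h z), fun h => LinearMap.ext fun z =>
    (Module.forall_dual_apply_eq_zero_iff ℂ _).1 (fun χ => by simpa using sub_eq_zero.2 (h χ z))
      |> sub_eq_zero.1⟩

/-- The counterpart of `overInv_iff` for `UnderInv`. -/
theorem underInv_iff {σ : X ⊗[ℂ] Y →ₗ[ℂ] Y ⊗[ℂ] X} {f : X →ₗ[ℂ] ℂ} :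
    UnderInv σ f ↔ ∀ (χ : Y →ₗ[ℂ] ℂ) (z : X ⊗[ℂ] Y), f (contrL χ (σ z)) = f (contrR χ z) := by
  have key (χ : Y →ₗ[ℂ] ℂ) (z : X ⊗[ℂ] Y) :
      (f (contrL χ (σ z)) = f (contrR χ z)) ↔ χ (contrR f (σ z)) = χ (contrL f z) := by
    rw [apply_contrR, apply_contrL, apply_contrL, apply_contrR]
  simp only [key]
  exact ⟨fun h χ z => congrArg χ (LinearMap.congr_fun h z), fun h => LinearMap.ext fun z =>
    (Module.forall_dual_apply_eq_zero_iff ℂ _).1 (fun χ => by simpa using sub_eq_zero.2 (h χ z))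
      |> sub_eq_zero.1⟩

theorem OverInv.comp {σ : X ⊗[ℂ] Y →ₗ[ℂ] Y ⊗[ℂ] X} {g : Y →ₗ[ℂ] ℂ} (h : OverInv σ g)
    {T : Y →ₗ[ℂ] Y} (hT : TensorProduct.map T LinearMap.id ∘ₗ σ =
      σ ∘ₗ TensorProduct.map LinearMap.id T) : OverInv σ (g ∘ₗ T) := by
  have h₁ := contrL_map g T (LinearMap.id : X →ₗ[ℂ] X)
  have h₂ := contrR_map g (LinearMap.id : X →ₗ[ℂ] X) T
  rw [LinearMap.id_comp] at h₁ h₂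
  rw [OverInv, ← h₁, LinearMap.comp_assoc, hT, ← LinearMap.comp_assoc, h, h₂]

theorem UnderInv.comp {σ : X ⊗[ℂ] Y →ₗ[ℂ] Y ⊗[ℂ] X} {f : X →ₗ[ℂ] ℂ} (h : UnderInv σ f)
    {T : X →ₗ[ℂ] X} (hT : TensorProduct.map LinearMap.id T ∘ₗ σ =
      σ ∘ₗ TensorProduct.map T LinearMap.id) : UnderInv σ (f ∘ₗ T) := by
  have h₁ := contrR_map f (LinearMap.id : Y →ₗ[ℂ] Y) T
  have h₂ := contrL_map f T (LinearMap.id : Y →ₗ[ℂ] Y)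
  rw [LinearMap.id_comp] at h₁ h₂
  rw [UnderInv, ← h₁, LinearMap.comp_assoc, hT, ← LinearMap.comp_assoc, h, h₂]

/-- The operator `(id ⊗ ψ) ∘ D`. -/
def actR (D : C →ₗ[ℂ] C ⊗[ℂ] C) (ψ : C →ₗ[ℂ] ℂ) : C →ₗ[ℂ] C := contrR ψ ∘ₗ D

/-- The operator `(ψ ⊗ id) ∘ D`. -/
def actL (D : C →ₗ[ℂ] C ⊗[ℂ] C) (ψ : C →ₗ[ℂ] ℂ) : C →ₗ[ℂ] C := contrL ψ ∘ₗ D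

theorem contrL_prodForm_midMap {σ : X ⊗[ℂ] Y →ₗ[ℂ] Y ⊗[ℂ] X} {g : Y →ₗ[ℂ] ℂ} (hg : OverInv σ g)
    (f : W →ₗ[ℂ] ℂ) :
    contrL (prodForm f g) ∘ₗ midMap (W := W) (Z := Z) σ =
      TensorProduct.map (contrL f) (contrL g) := by
  refine TensorProduct.ext_fourfold' fun w x y z => ?_
  have key (t : Y ⊗[ℂ] X) : contrL (prodForm f g)
      ((TensorProduct.assoc ℂ W Y (X ⊗[ℂ] Z)).symm (w ⊗ₜ TensorProduct.assoc ℂ Y X Z (t ⊗ₜ z))) =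
      f w • (contrL g t ⊗ₜ[ℂ] z) := by
    induction t with
    | zero => simp
    | tmul y x => simp [mul_smul, TensorProduct.smul_tmul']
    | add a b ha hb => simp only [TensorProduct.add_tmul, map_add, TensorProduct.tmul_add,
        smul_add, ha, hb]
  have h := key (σ (x ⊗ₜ y))
  rw [hg.apply] at h
  refine h.trans ?_
  rw [TensorProduct.map_tmul, contrL_tmul, contrL_tmul, TensorProduct.smul_tmul_smul, mul_smul,
    TensorProduct.smul_tmul', TensorProduct.smul_tmul', TensorProduct.smul_tmul']

theorem contrR_prodForm_midMap {σ : X ⊗[ℂ] Y →ₗ[ℂ] Y ⊗[ℂ] X} {f : X →ₗ[ℂ] ℂ} (hf : UnderInv σ f)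
    (g : Z →ₗ[ℂ] ℂ) :
    contrR (prodForm f g) ∘ₗ midMap (W := W) (Z := Z) σ =
      TensorProduct.map (contrR f) (contrR g) := by
  refine TensorProduct.ext_fourfold' fun w x y z => ?_
  have key (t : Y ⊗[ℂ] X) : contrR (prodForm f g)
      ((TensorProduct.assoc ℂ W Y (X ⊗[ℂ] Z)).symm (w ⊗ₜ TensorProduct.assoc ℂ Y X Z (t ⊗ₜ z))) =
      g z • (w ⊗ₜ[ℂ] contrR f t) := by
    induction t with
    | zero => simp
    | tmul y x => simp [mul_smul, smul_comm (f x)]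
    | add a b ha hb => simp only [TensorProduct.add_tmul, map_add, TensorProduct.tmul_add,
        smul_add, ha, hb]
  have h := key (σ (x ⊗ₜ y))
  rw [hf.apply] at h
  refine h.trans ?_
  rw [TensorProduct.map_tmul, contrR_tmul, contrR_tmul, TensorProduct.smul_tmul_smul, mul_comm,
    mul_smul, TensorProduct.tmul_smul]

/-- If `g` passes through the crossing, `f ⊗ g` acts factorwise: the twist of the comultiplication
disappears. -/
theorem actL_twistComul {σ : X ⊗[ℂ] Y →ₗ[ℂ] Y ⊗[ℂ] X} {g : Y →ₗ[ℂ] ℂ} (hg : OverInv σ g)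
    (f : X →ₗ[ℂ] ℂ) (DX : X →ₗ[ℂ] X ⊗[ℂ] X) (DY : Y →ₗ[ℂ] Y ⊗[ℂ] Y) :
    actL (twistComul σ DX DY) (prodForm f g) = TensorProduct.map (actL DX f) (actL DY g) := by
  rw [actL, twistComul, ← LinearMap.comp_assoc, contrL_prodForm_midMap hg, ← TensorProduct.map_comp]
  rfl

/-- The counterpart of `actL_twistComul` for the right action. -/
theorem actR_twistComul {σ : X ⊗[ℂ] Y →ₗ[ℂ] Y ⊗[ℂ] X} {f : X →ₗ[ℂ] ℂ} (hf : UnderInv σ f)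
    (g : Y →ₗ[ℂ] ℂ) (DX : X →ₗ[ℂ] X ⊗[ℂ] X) (DY : Y →ₗ[ℂ] Y ⊗[ℂ] Y) :
    actR (twistComul σ DX DY) (prodForm f g) = TensorProduct.map (actR DX f) (actR DY g) := by
  rw [actR, twistComul, ← LinearMap.comp_assoc, contrR_prodForm_midMap hf, ← TensorProduct.map_comp]
  rfl

theorem OverInv.crossRight {σ : X ⊗[ℂ] Y →ₗ[ℂ] Y ⊗[ℂ] X} {τ : X ⊗[ℂ] Z →ₗ[ℂ] Z ⊗[ℂ] X}
    {f : Y →ₗ[ℂ] ℂ} {g : Z →ₗ[ℂ] ℂ} (hf : OverInv σ f) (hg : OverInv τ g) :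
    OverInv (crossRight σ τ) (prodForm f g) := by
  refine TensorProduct.ext_threefold' fun x y z => ?_
  have k₂ (y : Y) (t : Z ⊗[ℂ] X) : contrL (prodForm f g)
      ((TensorProduct.assoc ℂ Y Z X).symm (y ⊗ₜ t)) = f y • contrL g t := by
    induction t with
    | zero => simp
    | tmul z x => simp [mul_smul]
    | add a b ha hb => simp only [map_add, TensorProduct.tmul_add, smul_add, ha, hb]
  have k₁ (t : Y ⊗[ℂ] X) : contrL (prodForm f g) ((TensorProduct.assoc ℂ Y Z X).symm
      (TensorProduct.map LinearMap.id τ (TensorProduct.assoc ℂ Y X Z (t ⊗ₜ z)))) =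
      g z • contrL f t := by
    induction t with
    | zero => simp
    | tmul y x =>
      rw [TensorProduct.assoc_tmul, TensorProduct.map_tmul, LinearMap.id_apply, k₂, hg.apply,
        contrL_tmul, smul_comm]
    | add a b ha hb => simp only [map_add, TensorProduct.add_tmul, smul_add, ha, hb]
  refine (k₁ (σ (x ⊗ₜ y))).trans ?_
  rw [hf.apply, contrR_tmul, prodForm_tmul, mul_comm, mul_smul]

theorem UnderInv.crossLeft {σ : X ⊗[ℂ] Z →ₗ[ℂ] Z ⊗[ℂ] X} {τ : Y ⊗[ℂ] Z →ₗ[ℂ] Z ⊗[ℂ] Y}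
    {f : X →ₗ[ℂ] ℂ} {g : Y →ₗ[ℂ] ℂ} (hf : UnderInv σ f) (hg : UnderInv τ g) :
    UnderInv (crossLeft σ τ) (prodForm f g) := by
  refine TensorProduct.ext_threefold fun x y z => ?_
  have k₂ (y : Y) (t : Z ⊗[ℂ] X) : contrR (prodForm f g)
      (TensorProduct.assoc ℂ Z X Y (t ⊗ₜ y)) = g y • contrR f t := by
    induction t with
    | zero => simp
    | tmul z x => simp [mul_smul, smul_comm (f x)]
    | add a b ha hb => simp only [map_add, TensorProduct.add_tmul, smul_add, ha, hb]
  have k₁ (t : Z ⊗[ℂ] Y) : contrR (prodForm f g) (TensorProduct.assoc ℂ Z X Y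
      (TensorProduct.map σ LinearMap.id ((TensorProduct.assoc ℂ X Z Y).symm (x ⊗ₜ t)))) =
      f x • contrR g t := by
    induction t with
    | zero => simp
    | tmul z y =>
      rw [TensorProduct.assoc_symm_tmul, TensorProduct.map_tmul, LinearMap.id_apply, k₂, hf.apply,
        contrR_tmul, smul_comm]
    | add a b ha hb => simp only [map_add, TensorProduct.tmul_add, smul_add, ha, hb]
  refine (k₁ (τ (y ⊗ₜ z))).trans ?_
  rw [hg.apply, contrL_tmul, prodForm_tmul, mul_smul]

theorem OverInv.crossLeft {σ : X ⊗[ℂ] Z →ₗ[ℂ] Z ⊗[ℂ] X} {τ : Y ⊗[ℂ] Z →ₗ[ℂ] Z ⊗[ℂ] Y}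
    {g : Z →ₗ[ℂ] ℂ} (hσ : OverInv σ g) (hτ : OverInv τ g) :
    OverInv (BraidedDeformation.crossLeft σ τ) g := by
  refine TensorProduct.ext_threefold fun x y z => ?_
  have k₂ (y : Y) (t : Z ⊗[ℂ] X) : contrL g (TensorProduct.assoc ℂ Z X Y (t ⊗ₜ y)) =
      contrL g t ⊗ₜ y := by
    induction t with
    | zero => simp
    | tmul z x => simp [TensorProduct.smul_tmul']
    | add a b ha hb => simp only [map_add, TensorProduct.add_tmul, ha, hb]
  have k₁ (t : Z ⊗[ℂ] Y) : contrL g (TensorProduct.assoc ℂ Z X Y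
      (TensorProduct.map σ LinearMap.id ((TensorProduct.assoc ℂ X Z Y).symm (x ⊗ₜ t)))) =
      x ⊗ₜ contrL g t := by
    induction t with
    | zero => simp
    | tmul z y =>
      rw [TensorProduct.assoc_symm_tmul, TensorProduct.map_tmul, LinearMap.id_apply, k₂, hσ.apply,
        contrL_tmul, TensorProduct.smul_tmul]
    | add a b ha hb => simp only [map_add, TensorProduct.tmul_add, ha, hb]
  refine (k₁ (τ (y ⊗ₜ z))).trans ?_
  rw [hτ.apply, contrR_tmul, TensorProduct.tmul_smul]

theorem UnderInv.crossRight {σ : X ⊗[ℂ] Y →ₗ[ℂ] Y ⊗[ℂ] X} {τ : X ⊗[ℂ] Z →ₗ[ℂ] Z ⊗[ℂ] X}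
    {f : X →ₗ[ℂ] ℂ} (hσ : UnderInv σ f) (hτ : UnderInv τ f) :
    UnderInv (BraidedDeformation.crossRight σ τ) f := by
  refine TensorProduct.ext_threefold' fun x y z => ?_
  have k₂ (y : Y) (t : Z ⊗[ℂ] X) : contrR f ((TensorProduct.assoc ℂ Y Z X).symm (y ⊗ₜ t)) =
      y ⊗ₜ contrR f t := by
    induction t with
    | zero => simp
    | tmul z x => simp
    | add a b ha hb => simp only [map_add, TensorProduct.tmul_add, ha, hb]
  have k₁ (t : Y ⊗[ℂ] X) : contrR f ((TensorProduct.assoc ℂ Y Z X).symm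
      (TensorProduct.map LinearMap.id τ (TensorProduct.assoc ℂ Y X Z (t ⊗ₜ z)))) =
      contrR f t ⊗ₜ z := by
    induction t with
    | zero => simp
    | tmul y x =>
      rw [TensorProduct.assoc_tmul, TensorProduct.map_tmul, LinearMap.id_apply, k₂, hτ.apply,
        contrR_tmul, TensorProduct.smul_tmul]
    | add a b ha hb => simp only [map_add, TensorProduct.add_tmul, ha, hb]
  refine (k₁ (σ (x ⊗ₜ y))).trans ?_
  rw [hσ.apply, contrL_tmul, TensorProduct.smul_tmul']

/-- If `D` and `g` can be pulled through `σ`, so can the operator `(id ⊗ g) ∘ D`. -/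
theorem ComulOver.map_actR {σ : X ⊗[ℂ] Y →ₗ[ℂ] Y ⊗[ℂ] X} {D : Y →ₗ[ℂ] Y ⊗[ℂ] Y} {g : Y →ₗ[ℂ] ℂ}
    (hD : ComulOver σ D) (hg : OverInv σ g) :
    TensorProduct.map (actR D g) LinearMap.id ∘ₗ σ =
      σ ∘ₗ TensorProduct.map LinearMap.id (actR D g) := by
  have h (T : Y →ₗ[ℂ] Y ⊗[ℂ] Y) : TensorProduct.map (contrR g ∘ₗ T) (LinearMap.id : X →ₗ[ℂ] X) =
      TensorProduct.map (contrR g) LinearMap.id ∘ₗ TensorProduct.map T LinearMap.id := by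
    rw [← TensorProduct.map_comp, LinearMap.id_comp]
  have h' (T : Y →ₗ[ℂ] Y ⊗[ℂ] Y) : TensorProduct.map (LinearMap.id : X →ₗ[ℂ] X) (contrR g ∘ₗ T) =
      TensorProduct.map LinearMap.id (contrR g) ∘ₗ TensorProduct.map LinearMap.id T := by
    rw [← TensorProduct.map_comp, LinearMap.id_comp]
  rw [actR, h, h', LinearMap.comp_assoc, hD, ← LinearMap.comp_assoc, ← LinearMap.comp_assoc]
  congr 1
  refine TensorProduct.ext_threefold' fun x y z => ?_
  have k₂ (y : Y) (t : Y ⊗[ℂ] X) : TensorProduct.map (contrR g) LinearMap.id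
      ((TensorProduct.assoc ℂ Y Y X).symm (y ⊗ₜ t)) = y ⊗ₜ contrL g t := by
    induction t with
    | zero => simp
    | tmul z x => simp [TensorProduct.smul_tmul]
    | add a b ha hb => simp only [map_add, TensorProduct.tmul_add, ha, hb]
  have k₁ (t : Y ⊗[ℂ] X) : TensorProduct.map (contrR g) LinearMap.id
      ((TensorProduct.assoc ℂ Y Y X).symm
        (TensorProduct.map LinearMap.id σ (TensorProduct.assoc ℂ Y X Y (t ⊗ₜ z)))) = g z • t := by
    induction t with
    | zero => simp
    | tmul y x =>
      rw [TensorProduct.assoc_tmul, TensorProduct.map_tmul, LinearMap.id_apply, k₂, hg.apply,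
        TensorProduct.tmul_smul]
    | add a b ha hb => simp only [map_add, TensorProduct.add_tmul, smul_add, ha, hb]
  refine (k₁ (σ (x ⊗ₜ y))).trans ?_
  simp

theorem ComulUnder.map_actR {σ : X ⊗[ℂ] Y →ₗ[ℂ] Y ⊗[ℂ] X} {D : X →ₗ[ℂ] X ⊗[ℂ] X} {f : X →ₗ[ℂ] ℂ}
    (hD : ComulUnder σ D) (hf : UnderInv σ f) :
    TensorProduct.map LinearMap.id (actR D f) ∘ₗ σ =
      σ ∘ₗ TensorProduct.map (actR D f) LinearMap.id := by
  have h (T : X →ₗ[ℂ] X ⊗[ℂ] X) : TensorProduct.map (contrR f ∘ₗ T) (LinearMap.id : Y →ₗ[ℂ] Y) =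
      TensorProduct.map (contrR f) LinearMap.id ∘ₗ TensorProduct.map T LinearMap.id := by
    rw [← TensorProduct.map_comp, LinearMap.id_comp]
  have h' (T : X →ₗ[ℂ] X ⊗[ℂ] X) : TensorProduct.map (LinearMap.id : Y →ₗ[ℂ] Y) (contrR f ∘ₗ T) =
      TensorProduct.map LinearMap.id (contrR f) ∘ₗ TensorProduct.map LinearMap.id T := by
    rw [← TensorProduct.map_comp, LinearMap.id_comp]
  rw [actR, h, h', LinearMap.comp_assoc, hD, ← LinearMap.comp_assoc, ← LinearMap.comp_assoc]
  congr 1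
  refine TensorProduct.ext_threefold fun x y z => ?_
  have k₂ (t : Y ⊗[ℂ] X) (y : X) : TensorProduct.map LinearMap.id (contrR f)
      (TensorProduct.assoc ℂ Y X X (t ⊗ₜ y)) = f y • t := by
    induction t with
    | zero => simp
    | tmul z x => simp
    | add a b ha hb => simp only [map_add, TensorProduct.add_tmul, smul_add, ha, hb]
  have k₁ (t : Y ⊗[ℂ] X) : TensorProduct.map LinearMap.id (contrR f)
      (TensorProduct.assoc ℂ Y X X (TensorProduct.map σ LinearMap.id
        ((TensorProduct.assoc ℂ X Y X).symm (x ⊗ₜ t)))) = σ (x ⊗ₜ contrR f t) := by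
    induction t with
    | zero => simp
    | tmul y x =>
      rw [TensorProduct.assoc_symm_tmul, TensorProduct.map_tmul, LinearMap.id_apply, k₂,
        contrR_tmul, TensorProduct.tmul_smul, map_smul]
    | add a b ha hb => simp only [map_add, TensorProduct.tmul_add, ha, hb]
  refine (k₁ (σ (y ⊗ₜ z))).trans ?_
  rw [hf.apply]
  simp [TensorProduct.smul_tmul]

end Functionals

/-! ### One-parameter groups and matrix coefficients of coalgebras -/

section OneParameter

open NormedSpace

/-- A one-parameter group in a Banach algebra that is continuous at `0` is an exponential. With
`F t = ∫₀ᵗ f`, some `F h` is invertible since `F h / h → 1`, and `f t * F h = F (t + h) - F t` shows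
that `f` is differentiable. -/
theorem exists_eq_exp_of_continuousAt {A : Type*} [NormedRing A] [NormedAlgebra ℝ A]
    [CompleteSpace A] {f : ℝ → A} (h₀ : f 0 = 1) (hadd : ∀ s t, f (s + t) = f s * f t)
    (hc : ContinuousAt f 0) : ∃ G : A, ∀ t : ℝ, f t = exp (t • G) := by
  have hcont : Continuous f := continuous_iff_continuousAt.2 fun t => by
    have h : ContinuousAt (fun s => f t * f (s - t)) t := by
      refine continuousAt_const.mul (ContinuousAt.comp (g := f) ?_ (by fun_prop))
      simpa using hc
    refine h.congr (Eventually.of_forall fun s => ?_)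
    simp [← hadd]
  set F : ℝ → A := fun t => ∫ s in (0 : ℝ)..t, f s with hF
  have hFd (t : ℝ) : HasDerivAt F (f t) t := hcont.integral_hasStrictDerivAt 0 t |>.hasDerivAt
  obtain ⟨h, u, hu⟩ : ∃ h, ∃ u : Aˣ, (u : A) = F h := by
    have hlim := (hFd 0).tendsto_slope
    rw [h₀] at hlim
    have hev := hlim.eventually (Units.isOpen.mem_nhds (isUnit_one (M := A)))
    obtain ⟨h, ⟨v, hv⟩, hne⟩ := (hev.and self_mem_nhdsWithin).exists
    have hne' : h ≠ 0 := hne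
    refine ⟨h, (Units.mk0 h hne') • v, ?_⟩
    simp only [Units.val_smul, hv, slope_def_module, sub_zero]
    simp [hF, Units.smul_def, smul_smul, hne']
  have key (t : ℝ) : f t = (F (t + h) - F t) * ↑u⁻¹ := by
    rw [Units.eq_mul_inv_iff_mul_eq, hu, hF]
    simp only
    rw [intervalIntegral.integral_interval_sub_left (hcont.intervalIntegrable _ _)
      (hcont.intervalIntegrable _ _)]
    refine ((ContinuousLinearMap.mul ℝ A (f t)).intervalIntegral_comp_comm
      (hcont.intervalIntegrable 0 h)).symm.trans ?_
    simp_rw [ContinuousLinearMap.mul_apply', ← hadd]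
    rw [intervalIntegral.integral_comp_add_left f t, add_zero]
  obtain ⟨G, hG⟩ : ∃ G, HasDerivAt f G 0 := by
    refine ⟨_, HasDerivAt.congr_of_eventuallyEq (HasDerivAt.mul_const
      (((hFd (0 + h)).comp_add_const 0 h).sub (hFd 0)) (↑u⁻¹ : A)) (Eventually.of_forall key)⟩
  have hd (t : ℝ) : HasDerivAt f (f t * G) t := by
    have h1 : HasDerivAt (fun s => f t * f (s + -t)) (f t * G) t := by
      refine HasDerivAt.const_mul _ (HasDerivAt.comp_add_const t (-t) ?_)
      simpa using hG
    refine h1.congr_of_eventuallyEq (Eventually.of_forall fun s => ?_)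
    simp [← hadd]
  refine ⟨G, fun t => ?_⟩
  -- `f` solves `f' = f * G`, so `f t * exp (-t G)` is constant.
  have hconst : ∀ t, HasDerivAt (fun t : ℝ => f t * exp (t • (-G))) 0 t := fun t => by
    have h := (hd t).mul (hasDerivAt_exp_smul_const' (𝕂 := ℝ) (-G) t)
    rwa [show f t * G * exp (t • -G) + f t * (-G * exp (t • -G)) = 0 by simp [mul_assoc]] at h
  have h1 : f t * exp (t • (-G)) = 1 := by
    rw [is_const_of_deriv_eq_zero (fun t => (hconst t).differentiableAt)
      (fun t => (hconst t).deriv) t 0]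
    simp [h₀]
  let _ : NormedAlgebra ℚ A := NormedAlgebra.restrictScalars ℚ ℝ A
  have h2 : exp (t • (-G)) * exp (t • G) = 1 := by
    rw [← exp_add_of_commute]
    · simp
    · exact ((Commute.refl G).neg_left.smul_left t).smul_right t
  calc f t = f t * (exp (t • (-G)) * exp (t • G)) := by rw [h2, mul_one]
    _ = exp (t • G) := by rw [← mul_assoc, h1, one_mul]

end OneParameter

section Coalgebra

variable {C : Type u} [AddCommGroup C] [Module ℂ C]

/-- All contractions of a fixed tensor lie in one finite-dimensional subspace; this is what makes the
subcomodule generated by an element finite-dimensional. -/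
theorem exists_finiteDimensional_contrR {X Y : Type u} [AddCommGroup X] [Module ℂ X]
    [AddCommGroup Y] [Module ℂ Y] (z : X ⊗[ℂ] Y) :
    ∃ W : Submodule ℂ X, FiniteDimensional ℂ W ∧ ∀ ψ : Y →ₗ[ℂ] ℂ, contrR ψ z ∈ W := by
  induction z with
  | zero => exact ⟨⊥, inferInstance, fun ψ => by simp⟩
  | tmul x y => exact ⟨ℂ ∙ x, inferInstance, fun ψ => Submodule.smul_mem _ _
      (Submodule.mem_span_singleton_self x)⟩
  | add a b ha hb =>
    obtain ⟨W₁, _, h₁⟩ := ha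
    obtain ⟨W₂, _, h₂⟩ := hb
    exact ⟨W₁ ⊔ W₂, inferInstance, fun ψ => by
      rw [map_add]
      exact Submodule.add_mem_sup (h₁ ψ) (h₂ ψ)⟩

/-- `(C, D, ε)` is a coalgebra. -/
structure IsCoalg (D : C →ₗ[ℂ] C ⊗[ℂ] C) (ε : C →ₗ[ℂ] ℂ) : Prop where
  coassoc : Coassoc D
  counit_left : actL D ε = LinearMap.id
  counit_right : actR D ε = LinearMap.id

section Act

variable (D : C →ₗ[ℂ] C ⊗[ℂ] C) (f g : C →ₗ[ℂ] ℂ)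

theorem prodForm_comp_eq_actR : prodForm f g ∘ₗ D = f ∘ₗ actR D g :=
  LinearMap.ext fun c => (apply_contrR f g (D c)).symm

theorem prodForm_comp_eq_actL : prodForm f g ∘ₗ D = g ∘ₗ actL D f :=
  LinearMap.ext fun c => (apply_contrL f g (D c)).symm

end Act

theorem Coassoc.comul_actR {D : C →ₗ[ℂ] C ⊗[ℂ] C} (hD : Coassoc D) (f : C →ₗ[ℂ] ℂ) :
    D ∘ₗ actR D f = TensorProduct.map LinearMap.id (actR D f) ∘ₗ D := by
  have h : contrR f = TensorProduct.map LinearMap.id (contrR f) ∘ₗ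
      (TensorProduct.assoc ℂ C C C).toLinearMap := by
    refine TensorProduct.ext_threefold fun x y z => ?_
    simp
  have h' : TensorProduct.map LinearMap.id (actR D f) = TensorProduct.map LinearMap.id (contrR f) ∘ₗ
      TensorProduct.map (LinearMap.id (M := C)) D := by
    rw [← TensorProduct.map_comp, LinearMap.id_comp, actR]
  rw [h', LinearMap.comp_assoc, ← hD, ← LinearMap.comp_assoc, ← h, ← LinearMap.comp_assoc,
    contrR_map, actR, LinearMap.comp_id, LinearMap.comp_assoc]

theorem Coassoc.comul_actL {D : C →ₗ[ℂ] C ⊗[ℂ] C} (hD : Coassoc D) (f : C →ₗ[ℂ] ℂ) :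
    D ∘ₗ actL D f = TensorProduct.map (actL D f) LinearMap.id ∘ₗ D := by
  have h : contrL f ∘ₗ (TensorProduct.assoc ℂ C C C).toLinearMap =
      TensorProduct.map (contrL f) LinearMap.id := by
    refine TensorProduct.ext_threefold fun x y z => ?_
    simp [TensorProduct.smul_tmul']
  have h' : TensorProduct.map (actL D f) LinearMap.id = TensorProduct.map (contrL f) LinearMap.id ∘ₗ
      TensorProduct.map D (LinearMap.id (M := C)) := by
    rw [← TensorProduct.map_comp, LinearMap.id_comp, actL]
  rw [h', ← h, LinearMap.comp_assoc, LinearMap.comp_assoc, hD, ← LinearMap.comp_assoc _ _ (contrL f),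
    contrL_map, actL, LinearMap.comp_id, LinearMap.comp_assoc]

theorem Coassoc.map_actR_id {D : C →ₗ[ℂ] C ⊗[ℂ] C} (hD : Coassoc D) (f : C →ₗ[ℂ] ℂ) :
    TensorProduct.map (actR D f) LinearMap.id ∘ₗ D =
      TensorProduct.map LinearMap.id (actL D f) ∘ₗ D := by
  have h : TensorProduct.map LinearMap.id (contrL f) ∘ₗ (TensorProduct.assoc ℂ C C C).toLinearMap =
      TensorProduct.map (contrR f) LinearMap.id := by
    refine TensorProduct.ext_threefold fun x y z => ?_
    simp [TensorProduct.smul_tmul']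
  have h₁ : TensorProduct.map (actR D f) LinearMap.id = TensorProduct.map (contrR f) LinearMap.id ∘ₗ
      TensorProduct.map D (LinearMap.id (M := C)) := by
    rw [← TensorProduct.map_comp, LinearMap.id_comp, actR]
  have h₂ : TensorProduct.map LinearMap.id (actL D f) = TensorProduct.map LinearMap.id (contrL f) ∘ₗ
      TensorProduct.map (LinearMap.id (M := C)) D := by
    rw [← TensorProduct.map_comp, LinearMap.id_comp, actL]
  rw [h₁, h₂, ← h, LinearMap.comp_assoc, LinearMap.comp_assoc, LinearMap.comp_assoc, hD]

theorem Coassoc.actL_comp {D : C →ₗ[ℂ] C ⊗[ℂ] C} (hD : Coassoc D) (f g : C →ₗ[ℂ] ℂ) :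
    actL D (g ∘ₗ actL D f) = actL D g ∘ₗ actL D f := by
  change contrL (g ∘ₗ actL D f) ∘ₗ D = (contrL g ∘ₗ D) ∘ₗ actL D f
  rw [LinearMap.comp_assoc, hD.comul_actL, ← LinearMap.comp_assoc, contrL_map,
    LinearMap.id_comp]

theorem Coassoc.actR_comp {D : C →ₗ[ℂ] C ⊗[ℂ] C} (hD : Coassoc D) (f g : C →ₗ[ℂ] ℂ) :
    actR D (f ∘ₗ actR D g) = actR D f ∘ₗ actR D g := by
  change contrR (f ∘ₗ actR D g) ∘ₗ D = (contrR f ∘ₗ D) ∘ₗ actR D g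
  rw [LinearMap.comp_assoc, hD.comul_actR, ← LinearMap.comp_assoc, contrR_map,
    LinearMap.id_comp]

theorem Coassoc.actL_actR {D : C →ₗ[ℂ] C ⊗[ℂ] C} (hD : Coassoc D) (f g : C →ₗ[ℂ] ℂ) :
    actL D f ∘ₗ actR D g = actR D g ∘ₗ actL D f := by
  rw [actL, LinearMap.comp_assoc, hD.comul_actR, ← LinearMap.comp_assoc, contrL_map,
    LinearMap.comp_id, LinearMap.comp_assoc]

/-- A square matrix of elements of a coalgebra whose evaluation is multiplicative for the
convolution of functionals: the matrix coefficients of a finite-dimensional comodule. -/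
structure IsCoeffMatrix (D : C →ₗ[ℂ] C ⊗[ℂ] C) (ε : C →ₗ[ℂ] ℂ) {n : ℕ}
    (m : Matrix (Fin n) (Fin n) C) : Prop where
  map_counit : m.map ε = 1
  map_conv : ∀ f g : C →ₗ[ℂ] ℂ, m.map (prodForm f g ∘ₗ D) = m.map f * m.map g

/-- Every element of a coalgebra is a linear combination of matrix coefficients of a
finite-dimensional comodule. -/
theorem IsCoalg.exists_isCoeffMatrix {D : C →ₗ[ℂ] C ⊗[ℂ] C} {ε : C →ₗ[ℂ] ℂ} (h : IsCoalg D ε)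
    (c : C) : ∃ (n : ℕ) (m : Matrix (Fin n) (Fin n) C) (u v : Fin n → ℂ), IsCoeffMatrix D ε m ∧
      ∀ ψ : C →ₗ[ℂ] ℂ, ψ c = ∑ i, ∑ j, u i * ψ (m i j) * v j := by
  -- the subcomodule generated by `c`
  let Φ : (C →ₗ[ℂ] ℂ) →ₗ[ℂ] C :=
    { toFun := fun ψ => actR D ψ c
      map_add' := fun f g => by
        simp [actR, contrR, TensorProduct.map_add_right]
      map_smul' := fun a f => by
        simp [actR, contrR, TensorProduct.map_smul_right] }
  let W := LinearMap.range Φ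
  obtain ⟨W', _, hW'⟩ := exists_finiteDimensional_contrR (D c)
  have hle : W ≤ W' := by
    rintro _ ⟨ψ, rfl⟩
    exact hW' ψ
  have : FiniteDimensional ℂ W := Submodule.finiteDimensional_of_le hle
  have hcW : c ∈ W := ⟨ε, LinearMap.congr_fun h.counit_right c⟩
  have hinv (ψ : C →ₗ[ℂ] ℂ) {w : C} (hw : w ∈ W) : actR D ψ w ∈ W := by
    obtain ⟨f, rfl⟩ := hw
    exact ⟨ψ ∘ₗ actR D f, LinearMap.congr_fun (h.coassoc.actR_comp ψ f) c⟩
  -- The matrix has entries `m i j = (l i ⊗ id) (D (b j))`, where `b` is a basis of `W` and `l` extends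
  -- its dual basis to functionals on `C`.
  let b := Module.finBasis ℂ W
  clear_value b
  choose l hl using fun i => LinearMap.exists_extend (b.coord i)
  have hsum {w : C} (hw : w ∈ W) : w = ∑ i, l i w • (b i : C) := by
    conv_lhs => rw [← Subtype.coe_mk w hw, ← b.sum_repr ⟨w, hw⟩]
    rw [Submodule.coe_sum]
    refine Finset.sum_congr rfl fun i _ => ?_
    rw [Submodule.coe_smul, ← b.coord_apply, ← hl i]
    rfl
  have hm (ψ : C →ₗ[ℂ] ℂ) (i j) : ψ (contrL (l i) (D (b j))) = l i (actR D ψ (b j)) := by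
    rw [apply_contrL, actR, LinearMap.comp_apply, apply_contrR]
  refine ⟨_, Matrix.of fun i j => contrL (l i) (D (b j)), fun i => ε (b i), fun j => l j c, ⟨?_, ?_⟩, ?_⟩
  · ext i j
    rw [Matrix.map_apply, Matrix.of_apply, hm, h.counit_right, LinearMap.id_apply]
    have := LinearMap.congr_fun (hl i) (b j)
    simp only [LinearMap.comp_apply, Submodule.subtype_apply] at this
    simp [this, Matrix.one_apply, Finsupp.single_apply, eq_comm]
  · intro f g
    ext i j
    simp only [Matrix.mul_apply, Matrix.map_apply, Matrix.of_apply, hm]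
    rw [prodForm_comp_eq_actR, h.coassoc.actR_comp, LinearMap.comp_apply]
    conv_lhs => rw [hsum (hinv g (b j).2)]
    simp only [map_sum, map_smul, smul_eq_mul]
    exact Finset.sum_congr rfl fun k _ => mul_comm _ _
  · intro ψ
    have h1 : ψ c = ε (actR D ψ c) := by
      rw [← LinearMap.comp_apply, ← prodForm_comp_eq_actR, prodForm_comp_eq_actL, h.counit_left]
      rfl
    simp_rw [Matrix.of_apply, hm]
    rw [h1]
    conv_lhs => rw [hsum hcW]
    simp only [map_sum, map_smul]
    rw [Finset.sum_comm]
    refine Finset.sum_congr rfl fun j _ => ?_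
    conv_lhs => rw [hsum (hinv ψ (b j).2)]
    simp only [map_sum, map_smul, smul_eq_mul, Finset.mul_sum]
    exact Finset.sum_congr rfl fun i _ => by ring

end Coalgebra

/-! ### Convolution exponentials -/

section Exponential

variable {C C' : Type u} [AddCommGroup C] [Module ℂ C] [AddCommGroup C'] [Module ℂ C']
  {D : C →ₗ[ℂ] C ⊗[ℂ] C} {ε : C →ₗ[ℂ] ℂ}

open NormedSpace

theorem convPow_succ (ψ : C →ₗ[ℂ] ℂ) (n : ℕ) :
    convPow D ε ψ (n + 1) = prodForm (convPow D ε ψ n) ψ ∘ₗ D := rfl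

theorem convPow_succ_eq_actR (ψ : C →ₗ[ℂ] ℂ) (n : ℕ) :
    convPow D ε ψ (n + 1) = convPow D ε ψ n ∘ₗ actR D ψ := by
  rw [convPow_succ, prodForm_comp_eq_actR]

theorem IsConvExp.unique {ψ E E' : C →ₗ[ℂ] ℂ} (h : IsConvExp D ε ψ E) (h' : IsConvExp D ε ψ E') :
    E = E' :=
  LinearMap.ext fun c => (h c).unique (h' c)

section CoeffMatrix

variable {n : ℕ} {m : Matrix (Fin n) (Fin n) C}

theorem IsCoeffMatrix.map_convPow (hm : IsCoeffMatrix D ε m) (ψ : C →ₗ[ℂ] ℂ) (k : ℕ) :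
    m.map (convPow D ε ψ k) = m.map ψ ^ k := by
  induction k with
  | zero => rw [pow_zero]; exact hm.map_counit
  | succ k ih => rw [convPow_succ, hm.map_conv, ih, pow_succ]

theorem IsCoeffMatrix.hasSum_convPow (hm : IsCoeffMatrix D ε m) (ψ : C →ₗ[ℂ] ℂ) (i j : Fin n) :
    HasSum (fun k => convPow D ε ψ k (m i j) / (k ! : ℂ)) (exp (m.map ψ) i j) := by
  have h : HasSum (fun k : ℕ => ((k ! : ℂ)⁻¹) • m.map ψ ^ k) (exp (m.map ψ)) := by
    open scoped Matrix.Norms.Operator in exact exp_series_hasSum_exp' (𝕂 := ℂ) (m.map ψ)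
  refine (Pi.hasSum.1 (Pi.hasSum.1 h i) j).congr_fun fun k => ?_
  rw [← hm.map_convPow]
  simp [div_eq_inv_mul]

theorem IsCoeffMatrix.map_convExp (hm : IsCoeffMatrix D ε m) {ψ E : C →ₗ[ℂ] ℂ}
    (hE : IsConvExp D ε ψ E) : m.map E = exp (m.map ψ) :=
  Matrix.ext fun i j => (hE (m i j)).unique (hm.hasSum_convPow ψ i j)

theorem IsCoeffMatrix.hasSum_of_eq (hm : IsCoeffMatrix D ε m) {c : C} {u v : Fin n → ℂ}
    (hc : ∀ f : C →ₗ[ℂ] ℂ, f c = ∑ i, ∑ j, u i * f (m i j) * v j) (ψ : C →ₗ[ℂ] ℂ) :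
    HasSum (fun k => convPow D ε ψ k c / (k ! : ℂ))
      (∑ i, ∑ j, u i * exp (m.map ψ) i j * v j) := by
  simp_rw [hc, Finset.sum_div]
  refine hasSum_sum fun i _ => hasSum_sum fun j _ => ?_
  refine (((hm.hasSum_convPow ψ i j).mul_left (u i)).mul_right (v j)).congr_fun fun k => ?_
  ring

end CoeffMatrix

/-- The exponential series of a functional on a coalgebra converges pointwise. -/
theorem IsCoalg.exists_isConvExp (h : IsCoalg D ε) (ψ : C →ₗ[ℂ] ℂ) :
    ∃ E, IsConvExp D ε ψ E := by
  have hs (c : C) : Summable fun k => convPow D ε ψ k c / (k ! : ℂ) := by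
    obtain ⟨n, m, u, v, hm, hc⟩ := h.exists_isCoeffMatrix c
    exact (hm.hasSum_of_eq hc ψ).summable
  refine ⟨{ toFun := fun c => ∑' k, convPow D ε ψ k c / (k ! : ℂ), map_add' := fun a b => ?_,
            map_smul' := fun r a => ?_ }, fun c => (hs c).hasSum⟩
  · rw [← (hs a).tsum_add (hs b)]
    simp_rw [map_add, add_div]
  · rw [RingHom.id_apply, smul_eq_mul, ← tsum_mul_left]
    simp_rw [map_smul, smul_eq_mul, mul_div_assoc]

/-- A functional whose evaluations on coefficient matrices are exponentials is a convolution
exponential. -/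
theorem IsCoalg.isConvExp_of_map (h : IsCoalg D ε) {ψ E : C →ₗ[ℂ] ℂ}
    (hE : ∀ (n : ℕ) (m : Matrix (Fin n) (Fin n) C), IsCoeffMatrix D ε m →
      m.map E = exp (m.map ψ)) : IsConvExp D ε ψ E := fun c => by
  obtain ⟨n, m, u, v, hm, hc⟩ := h.exists_isCoeffMatrix c
  have := hm.hasSum_of_eq hc ψ
  rw [← hE n m hm] at this
  rw [hc E]
  exact this

theorem IsCoalg.isConvExp_zero (h : IsCoalg D ε) : IsConvExp D ε 0 ε :=
  h.isConvExp_of_map fun n m hm => by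
    rw [hm.map_counit, show m.map (0 : C →ₗ[ℂ] ℂ) = 0 from rfl, exp_zero]

/-- The exponential of a sum of commuting functionals is the convolution of the exponentials. -/
theorem IsCoalg.isConvExp_add (h : IsCoalg D ε) {f g E F : C →ₗ[ℂ] ℂ} (hE : IsConvExp D ε f E)
    (hF : IsConvExp D ε g F) (hfg : prodForm f g ∘ₗ D = prodForm g f ∘ₗ D) :
    IsConvExp D ε (f + g) (prodForm E F ∘ₗ D) :=
  h.isConvExp_of_map fun n m hm => by
    rw [hm.map_conv, hm.map_convExp hE, hm.map_convExp hF, show m.map (f + g) = m.map f + m.map g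
      from rfl, Matrix.exp_add_of_commute]
    rw [Commute, SemiconjBy, ← hm.map_conv, ← hm.map_conv, hfg]

open scoped Matrix.Norms.Operator in
theorem hasDerivAt_exp_smul_entry {n : ℕ} (G : Matrix (Fin n) (Fin n) ℂ) (i j : Fin n) :
    HasDerivAt (fun t : ℝ => exp (t • G) i j) (G i j) 0 := by
  have h := hasDerivAt_exp_smul_const (𝕂 := ℝ) G 0
  rw [zero_smul, exp_zero, one_mul] at h
  exact (LinearMap.toContinuousLinearMap (Matrix.entryLinearMap ℝ ℂ i j)).hasFDerivAt.comp_hasDerivAt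
    0 h

/-- A pointwise continuous convolution group of functionals is differentiable and is generated by
its derivative. -/
theorem IsCoalg.exists_generator (h : IsCoalg D ε) {E : ℝ → C →ₗ[ℂ] ℂ} (h₀ : E 0 = ε)
    (hadd : ∀ s t, E (s + t) = prodForm (E s) (E t) ∘ₗ D)
    (hc : ∀ c, Tendsto (fun t => E t c) (𝓝 0) (𝓝 (ε c))) :
    ∃ L : C →ₗ[ℂ] ℂ, (∀ c, HasDerivAt (fun t => E t c) (L c) 0) ∧
      ∀ t : ℝ, IsConvExp D ε ((t : ℂ) • L) (E t) := by
  open scoped Matrix.Norms.Operator in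
  have hexp {n : ℕ} {m : Matrix (Fin n) (Fin n) C} (hm : IsCoeffMatrix D ε m) :
      ∃ G : Matrix (Fin n) (Fin n) ℂ, ∀ t : ℝ, m.map (E t) = exp (t • G) := by
    refine exists_eq_exp_of_continuousAt (f := fun t => m.map (E t)) ?_ ?_ ?_
    · rw [h₀, hm.map_counit]
    · intro s t
      rw [hadd, hm.map_conv]
    · refine tendsto_pi_nhds.2 fun i => tendsto_pi_nhds.2 fun j => ?_
      simpa [h₀] using hc (m i j)
  have hder {n : ℕ} {m : Matrix (Fin n) (Fin n) C} {G : Matrix (Fin n) (Fin n) ℂ}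
      (hG : ∀ t : ℝ, m.map (E t) = exp (t • G)) (i j : Fin n) :
      HasDerivAt (fun t => E t (m i j)) (G i j) 0 := by
    rw [show (fun t => E t (m i j)) = fun t : ℝ => exp (t • G) i j from
      funext fun t => congrFun (congrFun (hG t) i) j]
    exact hasDerivAt_exp_smul_entry G i j
  have hdiff (c : C) : DifferentiableAt ℝ (fun t => E t c) 0 := by
    obtain ⟨n, m, u, v, hm, hc⟩ := h.exists_isCoeffMatrix c
    obtain ⟨G, hG⟩ := hexp hm
    simp_rw [hc]
    refine DifferentiableAt.fun_sum fun i _ => DifferentiableAt.fun_sum fun j _ => ?_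
    exact ((hder hG i j).differentiableAt.const_mul _).mul_const _
  let L : C →ₗ[ℂ] ℂ :=
    { toFun := fun c => deriv (fun t => E t c) 0
      map_add' := fun a b => by
        simp_rw [map_add]
        exact deriv_fun_add (hdiff a) (hdiff b)
      map_smul' := fun r a => by
        simp_rw [map_smul, smul_eq_mul, RingHom.id_apply]
        exact deriv_const_mul r (hdiff a) }
  have hL (c : C) : HasDerivAt (fun t => E t c) (L c) 0 := (hdiff c).hasDerivAt
  refine ⟨L, hL, fun t => h.isConvExp_of_map fun n m hm => ?_⟩
  obtain ⟨G, hG⟩ := hexp hm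
  have hLG : m.map ((t : ℂ) • L) = t • G := by
    ext i j
    rw [Matrix.map_apply, Matrix.smul_apply, LinearMap.smul_apply,
      (hL (m i j)).unique (hder hG i j)]
    simp
  rw [hG, hLG]

/-- The exponentials `e^{tL}` are pointwise continuous at `t = 0`. -/
theorem IsCoalg.tendsto_convExp (h : IsCoalg D ε) {L : C →ₗ[ℂ] ℂ} {E : ℝ → C →ₗ[ℂ] ℂ}
    (hE : ∀ t : ℝ, IsConvExp D ε ((t : ℂ) • L) (E t)) (c : C) :
    Tendsto (fun t => E t c) (𝓝 0) (𝓝 (E 0 c)) := by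
  obtain ⟨n, m, u, v, hm, hc⟩ := h.exists_isCoeffMatrix c
  simp_rw [hc]
  refine tendsto_finsetSum _ fun i _ => tendsto_finsetSum _ fun j _ => ?_
  refine (Tendsto.const_mul _ ?_).mul_const _
  have hij (t : ℝ) : E t (m i j) = exp ((t : ℂ) • m.map L) i j := by
    have := congrFun (congrFun (hm.map_convExp (hE t)) i) j
    exact this
  simp_rw [hij]
  have hcont : Continuous fun t : ℝ => exp ((t : ℂ) • m.map L) := by
    open scoped Matrix.Norms.Operator in
    exact exp_continuous.comp (by fun_prop)
  exact (continuous_apply_apply i j).comp hcont |>.tendsto 0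

theorem IsCoalg.convExp_add (h : IsCoalg D ε) {L : C →ₗ[ℂ] ℂ} {E : ℝ → C →ₗ[ℂ] ℂ}
    (hE : ∀ t : ℝ, IsConvExp D ε ((t : ℂ) • L) (E t)) (s t : ℝ) :
    E (s + t) = prodForm (E s) (E t) ∘ₗ D := by
  refine (hE (s + t)).unique ?_
  rw [Complex.ofReal_add, add_smul]
  refine h.isConvExp_add (hE s) (hE t) ?_
  have hp (a b : ℂ) : prodForm (a • L) (b • L) = (a * b) • prodForm L L := by
    ext x y
    simp
    ring
  rw [hp, hp, mul_comm]

/-- `f` is a homomorphism of coalgebras from `(C, D, ε)` to `(C', D', ε')`. -/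
structure IsCoalgHom (D : C →ₗ[ℂ] C ⊗[ℂ] C) (ε : C →ₗ[ℂ] ℂ) (D' : C' →ₗ[ℂ] C' ⊗[ℂ] C')
    (ε' : C' →ₗ[ℂ] ℂ) (f : C →ₗ[ℂ] C') : Prop where
  comul : D' ∘ₗ f = TensorProduct.map f f ∘ₗ D
  counit : ε' ∘ₗ f = ε

namespace IsCoalgHom

variable {D' : C' →ₗ[ℂ] C' ⊗[ℂ] C'} {ε' : C' →ₗ[ℂ] ℂ} {f : C →ₗ[ℂ] C'}

theorem prodForm_comp (hf : IsCoalgHom D ε D' ε' f) (a b : C' →ₗ[ℂ] ℂ) :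
    prodForm (a ∘ₗ f) (b ∘ₗ f) ∘ₗ D = (prodForm a b ∘ₗ D') ∘ₗ f := by
  rw [LinearMap.comp_assoc, hf.comul, ← LinearMap.comp_assoc]
  congr 1
  ext x y
  simp

theorem actR_comp (hf : IsCoalgHom D ε D' ε' f) (a : C' →ₗ[ℂ] ℂ) :
    actR D' a ∘ₗ f = f ∘ₗ actR D (a ∘ₗ f) := by
  rw [actR, LinearMap.comp_assoc, hf.comul, ← LinearMap.comp_assoc, contrR_map]
  rfl

theorem convPow_comp (hf : IsCoalgHom D ε D' ε' f) (ψ : C' →ₗ[ℂ] ℂ) (n : ℕ) :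
    convPow D ε (ψ ∘ₗ f) n = convPow D' ε' ψ n ∘ₗ f := by
  induction n with
  | zero => exact hf.counit.symm
  | succ n ih => rw [convPow_succ, convPow_succ, ih, hf.prodForm_comp]

theorem isConvExp_comp (hf : IsCoalgHom D ε D' ε' f) {ψ E : C' →ₗ[ℂ] ℂ}
    (hE : IsConvExp D' ε' ψ E) : IsConvExp D ε (ψ ∘ₗ f) (E ∘ₗ f) := fun c => by
  simp_rw [hf.convPow_comp]
  exact hE (f c)

end IsCoalgHom

end Exponential

/-! ### Twisted tensor products of coalgebras -/

section Crossed

variable {W X X' Y Y' Z : Type u} [AddCommGroup W] [Module ℂ W]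
  [AddCommGroup X] [Module ℂ X] [AddCommGroup X'] [Module ℂ X']
  [AddCommGroup Y] [Module ℂ Y] [AddCommGroup Y'] [Module ℂ Y'] [AddCommGroup Z] [Module ℂ Z]
  {DX : X →ₗ[ℂ] X ⊗[ℂ] X} {εX : X →ₗ[ℂ] ℂ} {DX' : X' →ₗ[ℂ] X' ⊗[ℂ] X'} {εX' : X' →ₗ[ℂ] ℂ}
  {DY : Y →ₗ[ℂ] Y ⊗[ℂ] Y} {εY : Y →ₗ[ℂ] ℂ} {DY' : Y' →ₗ[ℂ] Y' ⊗[ℂ] Y'} {εY' : Y' →ₗ[ℂ] ℂ}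

/-- The twisted tensor product of two coalgebras is a coalgebra. -/
theorem IsCoalg.twistComul {σ : X ⊗[ℂ] Y →ₗ[ℂ] Y ⊗[ℂ] X} (hX : IsCoalg DX εX) (hY : IsCoalg DY εY)
    (h₁ : ComulOver σ DY) (h₂ : ComulUnder σ DX) (h₃ : OverInv σ εY) (h₄ : UnderInv σ εX) :
    IsCoalg (twistComul σ DX DY) (prodForm εX εY) where
  coassoc := hX.coassoc.twistComul hY.coassoc h₁ h₂
  counit_left := by
    rw [actL_twistComul h₃, hX.counit_left, hY.counit_left, TensorProduct.map_id]
  counit_right := by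
    rw [actR_twistComul h₄, hX.counit_right, hY.counit_right, TensorProduct.map_id]

theorem midMap_naturality_left {σ : X ⊗[ℂ] Y →ₗ[ℂ] Y ⊗[ℂ] X} {σ' : X' ⊗[ℂ] Y →ₗ[ℂ] Y ⊗[ℂ] X'}
    {f : X →ₗ[ℂ] X'} (h : TensorProduct.map LinearMap.id f ∘ₗ σ =
      σ' ∘ₗ TensorProduct.map f LinearMap.id) (k : W →ₗ[ℂ] Z) :
    midMap σ' ∘ₗ TensorProduct.map (TensorProduct.map k f) (TensorProduct.map LinearMap.id
      LinearMap.id) = TensorProduct.map (TensorProduct.map k LinearMap.id)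
        (TensorProduct.map f (LinearMap.id (M := Y'))) ∘ₗ midMap σ := by
  refine TensorProduct.ext_fourfold' fun w x y z => ?_
  have key (t : Y ⊗[ℂ] X) : (TensorProduct.assoc ℂ Z Y (X' ⊗[ℂ] Y')).symm
      (k w ⊗ₜ TensorProduct.assoc ℂ Y X' Y' (TensorProduct.map LinearMap.id f t ⊗ₜ z)) =
      TensorProduct.map (TensorProduct.map k LinearMap.id) (TensorProduct.map f LinearMap.id)
        ((TensorProduct.assoc ℂ W Y (X ⊗[ℂ] Y')).symm
          (w ⊗ₜ TensorProduct.assoc ℂ Y X Y' (t ⊗ₜ z))) := by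
    induction t with
    | zero => simp
    | tmul y x => simp
    | add a b ha hb => simp only [map_add, TensorProduct.add_tmul, TensorProduct.tmul_add, ha, hb]
  refine Eq.trans ?_ (key (σ (x ⊗ₜ y)))
  rw [show TensorProduct.map LinearMap.id f (σ (x ⊗ₜ y)) = σ' (f x ⊗ₜ y) from
    LinearMap.congr_fun h (x ⊗ₜ y)]
  rfl

theorem midMap_naturality_right {σ : X ⊗[ℂ] Y →ₗ[ℂ] Y ⊗[ℂ] X} {σ' : X ⊗[ℂ] Y' →ₗ[ℂ] Y' ⊗[ℂ] X}
    {f : Y →ₗ[ℂ] Y'} (h : TensorProduct.map f LinearMap.id ∘ₗ σ =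
      σ' ∘ₗ TensorProduct.map LinearMap.id f) (k : W →ₗ[ℂ] Z) :
    midMap σ' ∘ₗ TensorProduct.map (TensorProduct.map LinearMap.id LinearMap.id)
      (TensorProduct.map f k) = TensorProduct.map (TensorProduct.map (LinearMap.id (M := X')) f)
        (TensorProduct.map LinearMap.id k) ∘ₗ midMap σ := by
  refine TensorProduct.ext_fourfold' fun w x y z => ?_
  have key (t : Y ⊗[ℂ] X) : (TensorProduct.assoc ℂ X' Y' (X ⊗[ℂ] Z)).symm
      (w ⊗ₜ TensorProduct.assoc ℂ Y' X Z (TensorProduct.map f LinearMap.id t ⊗ₜ k z)) =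
      TensorProduct.map (TensorProduct.map LinearMap.id f) (TensorProduct.map LinearMap.id k)
        ((TensorProduct.assoc ℂ X' Y (X ⊗[ℂ] W)).symm
          (w ⊗ₜ TensorProduct.assoc ℂ Y X W (t ⊗ₜ z))) := by
    induction t with
    | zero => simp
    | tmul y x => simp
    | add a b ha hb => simp only [map_add, TensorProduct.add_tmul, TensorProduct.tmul_add, ha, hb]
  refine Eq.trans ?_ (key (σ (x ⊗ₜ y)))
  rw [show TensorProduct.map f LinearMap.id (σ (x ⊗ₜ y)) = σ' (x ⊗ₜ f y) from
    LinearMap.congr_fun h (x ⊗ₜ y)]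
  rfl

theorem IsCoalgHom.map_id {σ : X ⊗[ℂ] Y →ₗ[ℂ] Y ⊗[ℂ] X} {σ' : X' ⊗[ℂ] Y →ₗ[ℂ] Y ⊗[ℂ] X'}
    {f : X →ₗ[ℂ] X'} (hf : IsCoalgHom DX εX DX' εX' f)
    (h : TensorProduct.map LinearMap.id f ∘ₗ σ = σ' ∘ₗ TensorProduct.map f LinearMap.id)
    (DY : Y →ₗ[ℂ] Y ⊗[ℂ] Y) (εY : Y →ₗ[ℂ] ℂ) :
    IsCoalgHom (BraidedDeformation.twistComul σ DX DY) (prodForm εX εY)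
      (BraidedDeformation.twistComul σ' DX' DY) (prodForm εX' εY)
      (TensorProduct.map f LinearMap.id) where
  comul := by
    rw [BraidedDeformation.twistComul, BraidedDeformation.twistComul, ← LinearMap.comp_assoc,
      ← midMap_naturality_left h, LinearMap.comp_assoc, LinearMap.comp_assoc,
      ← TensorProduct.map_comp, ← TensorProduct.map_comp, hf.comul, TensorProduct.map_id]
    rfl
  counit := by
    rw [← hf.counit]
    ext x y
    simp

theorem IsCoalgHom.id_map {σ : X ⊗[ℂ] Y →ₗ[ℂ] Y ⊗[ℂ] X} {σ' : X ⊗[ℂ] Y' →ₗ[ℂ] Y' ⊗[ℂ] X}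
    {f : Y →ₗ[ℂ] Y'} (hf : IsCoalgHom DY εY DY' εY' f)
    (h : TensorProduct.map f LinearMap.id ∘ₗ σ = σ' ∘ₗ TensorProduct.map LinearMap.id f)
    (DX : X →ₗ[ℂ] X ⊗[ℂ] X) (εX : X →ₗ[ℂ] ℂ) :
    IsCoalgHom (BraidedDeformation.twistComul σ DX DY) (prodForm εX εY)
      (BraidedDeformation.twistComul σ' DX DY') (prodForm εX εY')
      (TensorProduct.map LinearMap.id f) where
  comul := by
    rw [BraidedDeformation.twistComul, BraidedDeformation.twistComul, ← LinearMap.comp_assoc,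
      ← midMap_naturality_right h, LinearMap.comp_assoc, LinearMap.comp_assoc,
      ← TensorProduct.map_comp, ← TensorProduct.map_comp, hf.comul, TensorProduct.map_id]
    rfl
  counit := by
    rw [← hf.counit]
    ext x y
    simp

theorem map_contrR_midMap {σ : X ⊗[ℂ] Y →ₗ[ℂ] Y ⊗[ℂ] X} {g : Y →ₗ[ℂ] ℂ} (hg : OverInv σ g)
    (k : Z →ₗ[ℂ] ℂ) :
    TensorProduct.map (contrR g) (contrR k) ∘ₗ midMap (W := W) σ = contrR (prodForm g k) := by
  refine TensorProduct.ext_fourfold' fun w x y z => ?_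
  have key (t : Y ⊗[ℂ] X) : TensorProduct.map (contrR g) (contrR k)
      ((TensorProduct.assoc ℂ W Y (X ⊗[ℂ] Z)).symm (w ⊗ₜ TensorProduct.assoc ℂ Y X Z (t ⊗ₜ z))) =
      k z • (w ⊗ₜ[ℂ] contrL g t) := by
    induction t with
    | zero => simp
    | tmul y x => simp [TensorProduct.smul_tmul]
    | add a b ha hb => simp only [TensorProduct.add_tmul, map_add, TensorProduct.tmul_add,
        smul_add, ha, hb]
  refine (key (σ (x ⊗ₜ y))).trans ?_
  rw [hg.apply, contrR_tmul, prodForm_tmul, TensorProduct.tmul_smul, smul_smul, mul_comm]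

theorem map_contrL_midMap {σ : X ⊗[ℂ] Y →ₗ[ℂ] Y ⊗[ℂ] X} {f : X →ₗ[ℂ] ℂ} (hf : UnderInv σ f)
    (k : W →ₗ[ℂ] ℂ) :
    TensorProduct.map (contrL k) (contrL f) ∘ₗ midMap (Z := Z) σ = contrL (prodForm k f) := by
  refine TensorProduct.ext_fourfold' fun w x y z => ?_
  have key (t : Y ⊗[ℂ] X) : TensorProduct.map (contrL k) (contrL f)
      ((TensorProduct.assoc ℂ W Y (X ⊗[ℂ] Z)).symm (w ⊗ₜ TensorProduct.assoc ℂ Y X Z (t ⊗ₜ z))) =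
      k w • (contrR f t ⊗ₜ[ℂ] z) := by
    induction t with
    | zero => simp
    | tmul y x => simp only [TensorProduct.assoc_tmul, TensorProduct.assoc_symm_tmul,
        TensorProduct.map_tmul, contrL_tmul, contrR_tmul, TensorProduct.tmul_smul,
        ← TensorProduct.smul_tmul', smul_comm (f x) (k w)]
    | add a b ha hb => simp only [TensorProduct.add_tmul, map_add, TensorProduct.tmul_add,
        smul_add, ha, hb]
  refine (key (σ (x ⊗ₜ y))).trans ?_
  rw [hf.apply, contrL_tmul, prodForm_tmul, ← TensorProduct.smul_tmul', smul_smul]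

theorem IsCoalg.prodForm_counit (h : IsCoalg DX εX) : prodForm εX εX ∘ₗ DX = εX := by
  rw [prodForm_comp_eq_actR, h.counit_right, LinearMap.comp_id]

/-- Applying the counit of the second factor of a twisted tensor product is a homomorphism. -/
theorem IsCoalg.isCoalgHom_contrR {σ : X ⊗[ℂ] Y →ₗ[ℂ] Y ⊗[ℂ] X} (hY : IsCoalg DY εY)
    (h : OverInv σ εY) (DX : X →ₗ[ℂ] X ⊗[ℂ] X) (εX : X →ₗ[ℂ] ℂ) :
    IsCoalgHom (BraidedDeformation.twistComul σ DX DY) (prodForm εX εY) DX εX (contrR εY) where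
  comul := by
    rw [BraidedDeformation.twistComul, ← LinearMap.comp_assoc, map_contrR_midMap h, contrR_map,
      hY.prodForm_counit]
  counit := LinearMap.ext fun z => apply_contrR _ _ z

theorem IsCoalg.isCoalgHom_contrL {σ : X ⊗[ℂ] Y →ₗ[ℂ] Y ⊗[ℂ] X} (hX : IsCoalg DX εX)
    (h : UnderInv σ εX) (DY : Y →ₗ[ℂ] Y ⊗[ℂ] Y) (εY : Y →ₗ[ℂ] ℂ) :
    IsCoalgHom (BraidedDeformation.twistComul σ DX DY) (prodForm εX εY) DY εY (contrL εX) where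
  comul := by
    rw [BraidedDeformation.twistComul, ← LinearMap.comp_assoc, map_contrL_midMap h, contrL_map,
      hX.prodForm_counit]
  counit := LinearMap.ext fun z => apply_contrL _ _ z

/-- Convolution exponentials inherit the property of passing through a crossing. -/
theorem OverInv.convExp {σ : X ⊗[ℂ] Y →ₗ[ℂ] Y ⊗[ℂ] X} (hD : ComulOver σ DY) (hε : OverInv σ εY)
    {ψ E : Y →ₗ[ℂ] ℂ} (hψ : OverInv σ ψ) (hE : IsConvExp DY εY ψ E) : OverInv σ E := by
  have hpow (n : ℕ) : OverInv σ (convPow DY εY ψ n) := by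
    induction n with
    | zero => exact hε
    | succ n ih =>
      rw [convPow_succ_eq_actR]
      exact ih.comp (hD.map_actR hψ)
  refine overInv_iff.2 fun χ z => (hE _).unique ?_
  simp_rw [overInv_iff.1 (hpow _) χ z]
  exact hE _

theorem UnderInv.convExp {σ : X ⊗[ℂ] Y →ₗ[ℂ] Y ⊗[ℂ] X} (hD : ComulUnder σ DX) (hε : UnderInv σ εX)
    {ψ E : X →ₗ[ℂ] ℂ} (hψ : UnderInv σ ψ) (hE : IsConvExp DX εX ψ E) : UnderInv σ E := by
  have hpow (n : ℕ) : UnderInv σ (convPow DX εX ψ n) := by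
    induction n with
    | zero => exact hε
    | succ n ih =>
      rw [convPow_succ_eq_actR]
      exact ih.comp (hD.map_actR hψ)
  refine underInv_iff.2 fun χ z => (hE _).unique ?_
  simp_rw [underInv_iff.1 (hpow _) χ z]
  exact hE _

end Crossed

section Compatible

variable {V M : Type u} [AddCommGroup V] [Module ℂ V] [AddCommGroup M] [Module ℂ M]

theorem isCompatible_unit_iff {o : V ⊗[ℂ] M →ₗ[ℂ] M ⊗[ℂ] V} {w : M ⊗[ℂ] V →ₗ[ℂ] V ⊗[ℂ] M}
    {f : M →ₗ[ℂ] ℂ} : IsCompatible o braid10 w braid01 f ↔ OverInv o f ∧ UnderInv w f := by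
  have h₁ : (TensorProduct.lid ℂ V).toLinearMap ∘ₗ braid10 ∘ₗ TensorProduct.map LinearMap.id f =
      contrR f := by
    ext v x
    simp [braid10]
  have h₂ : (TensorProduct.rid ℂ V).toLinearMap ∘ₗ braid01 ∘ₗ TensorProduct.map f LinearMap.id =
      contrL f := by
    ext v x
    simp [braid01]
  constructor
  · intro h
    refine ⟨?_, ?_⟩
    · rw [OverInv, ← h₁, ← h.invariant]; rfl
    · rw [UnderInv, ← h₂, ← h.inv_invariant]; rfl
  · rintro ⟨h, h'⟩
    refine ⟨?_, ?_⟩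
    · refine LinearMap.ext fun z => (TensorProduct.lid ℂ V).injective ?_
      exact LinearMap.congr_fun (h.trans h₁.symm) z
    · refine LinearMap.ext fun z => (TensorProduct.rid ℂ V).injective ?_
      exact LinearMap.congr_fun (h'.trans h₂.symm) z

theorem formCompatible_iff {β : V ⊗[ℂ] V ≃ₗ[ℂ] V ⊗[ℂ] V} {L : V ⊗[ℂ] V →ₗ[ℂ] ℂ} :
    FormCompatible β L ↔ OverInv (braid12 β) L ∧ UnderInv (braid21 β) L :=
  isCompatible_unit_iff

theorem IsCompatible.comp {N P : Type*} [AddCommGroup N] [Module ℂ N] [AddCommGroup P]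
    [Module ℂ P] {oM : V ⊗[ℂ] M →ₗ[ℂ] M ⊗[ℂ] V} {oN : V ⊗[ℂ] N →ₗ[ℂ] N ⊗[ℂ] V}
    {oP : V ⊗[ℂ] P →ₗ[ℂ] P ⊗[ℂ] V} {wM : M ⊗[ℂ] V →ₗ[ℂ] V ⊗[ℂ] M} {wN : N ⊗[ℂ] V →ₗ[ℂ] V ⊗[ℂ] N}
    {wP : P ⊗[ℂ] V →ₗ[ℂ] V ⊗[ℂ] P} {g : N →ₗ[ℂ] P} {f : M →ₗ[ℂ] N}
    (hg : IsCompatible oN oP wN wP g) (hf : IsCompatible oM oN wM wN f) :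
    IsCompatible oM oP wM wP (g ∘ₗ f) where
  invariant := by
    rw [← LinearMap.id_comp (LinearMap.id (M := V)), TensorProduct.map_comp,
      TensorProduct.map_comp, LinearMap.comp_assoc, hf.invariant, ← LinearMap.comp_assoc,
      hg.invariant, LinearMap.comp_assoc]
  inv_invariant := by
    rw [← LinearMap.id_comp (LinearMap.id (M := V)), TensorProduct.map_comp,
      TensorProduct.map_comp, LinearMap.comp_assoc, hf.inv_invariant, ← LinearMap.comp_assoc,
      hg.inv_invariant, LinearMap.comp_assoc]

end Compatible

/-! ### The coalgebras of a braided bialgebra and associativity of the deformed products -/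

section Deformation

variable {B : Type u} [Ring B] [Algebra ℂ B] [Coalgebra ℂ B] {β : B ⊗[ℂ] B ≃ₗ[ℂ] B ⊗[ℂ] B}

/-- `μ ⋆ K = μ ∘ (id ⊗ K) ∘ Λ`: convolution with a functional acts on the argument of `μ`. -/
theorem mulConv_eq (K : B ⊗[ℂ] B →ₗ[ℂ] ℂ) :
    mulConv β K = LinearMap.mul' ℂ B ∘ₗ actR (tensorComul β) K := by
  rw [actR, ← LinearMap.comp_assoc, mulConv, conv, ← LinearMap.comp_assoc]
  congr 1
  ext a b c d
  simp

theorem convMul_eq (K : B ⊗[ℂ] B →ₗ[ℂ] ℂ) :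
    convMul β K = LinearMap.mul' ℂ B ∘ₗ actL (tensorComul β) K := by
  rw [actL, ← LinearMap.comp_assoc, convMul, conv, ← LinearMap.comp_assoc]
  congr 1
  ext a b c d
  simp

theorem isCoalg_comul : IsCoalg (Coalgebra.comul (R := ℂ) (A := B)) Coalgebra.counit where
  coassoc := Coalgebra.coassoc
  counit_left := LinearMap.ext fun b => by
    refine (congrArg (TensorProduct.lid ℂ B) (Coalgebra.rTensor_counit_comul (R := ℂ) b)).trans ?_
    simp
  counit_right := LinearMap.ext fun b => by
    refine (congrArg (TensorProduct.rid ℂ B) (Coalgebra.lTensor_counit_comul (R := ℂ) b)).trans ?_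
    simp

namespace IsBraidedBialgebra

variable (hB : IsBraidedBialgebra β)
include hB

theorem overInv_counit : OverInv β.toLinearMap (Coalgebra.counit (R := ℂ) (A := B)) :=
  (isCompatible_unit_iff.1 hB.coalgebra.counit_compatible).1

theorem underInv_counit : UnderInv β.toLinearMap (Coalgebra.counit (R := ℂ) (A := B)) :=
  (isCompatible_unit_iff.1 hB.coalgebra.counit_compatible).2

theorem comulOver : ComulOver β.toLinearMap (Coalgebra.comul (R := ℂ) (A := B)) :=
  hB.coalgebra.comul_compatible.invariant

theorem comulUnder : ComulUnder β.toLinearMap (Coalgebra.comul (R := ℂ) (A := B)) :=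
  hB.coalgebra.comul_compatible.inv_invariant

theorem comulOver_tensor : ComulOver (braid12 β) (tensorComul β) :=
  hB.algebra.braiding.comulOver_twistComul hB.comulOver

theorem comulUnder_tensor : ComulUnder (braid21 β) (tensorComul β) :=
  hB.algebra.braiding.comulUnder_twistComul hB.comulUnder

theorem overInv_tensorCounit : OverInv (braid12 β) (tensorCounit B) :=
  hB.overInv_counit.crossRight hB.overInv_counit

theorem underInv_tensorCounit : UnderInv (braid21 β) (tensorCounit B) :=
  hB.underInv_counit.crossLeft hB.underInv_counit

/-- `(B ⊗ B, Λ, δ ⊗ δ)` is a coalgebra. -/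
theorem isCoalg_tensor : IsCoalg (tensorComul β) (tensorCounit B) :=
  isCoalg_comul.twistComul isCoalg_comul hB.comulOver hB.comulUnder hB.overInv_counit
    hB.underInv_counit

/-- The multiplication is a homomorphism of coalgebras. -/
theorem isCoalgHom_mul : IsCoalgHom (tensorComul β) (tensorCounit B)
    (Coalgebra.comul (R := ℂ) (A := B)) Coalgebra.counit (LinearMap.mul' ℂ B) where
  comul := hB.comul_mul
  counit := hB.counit_mul

theorem isCoalgHom_mul_id : IsCoalgHom
    (twistComul (braid21 β) (tensorComul β) (Coalgebra.comul (R := ℂ) (A := B)))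
    (prodForm (tensorCounit B) Coalgebra.counit) (tensorComul β) (tensorCounit B)
    (TensorProduct.map (LinearMap.mul' ℂ B) LinearMap.id) :=
  hB.isCoalgHom_mul.map_id hB.algebra.mul_compatible.inv_invariant _ _

theorem isCoalgHom_id_mul : IsCoalgHom
    (twistComul (braid12 β) (Coalgebra.comul (R := ℂ) (A := B)) (tensorComul β))
    (prodForm Coalgebra.counit (tensorCounit B)) (tensorComul β) (tensorCounit B)
    (TensorProduct.map LinearMap.id (LinearMap.mul' ℂ B)) :=
  hB.isCoalgHom_mul.id_map hB.algebra.mul_compatible.invariant _ _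

/-- `B ⊗ B ⊗ B`, with the comultiplication twisted by `β_{2,1}`, is a coalgebra. -/
theorem isCoalg_triple : IsCoalg
    (twistComul (braid21 β) (tensorComul β) (Coalgebra.comul (R := ℂ) (A := B)))
    (prodForm (tensorCounit B) Coalgebra.counit) :=
  hB.isCoalg_tensor.twistComul isCoalg_comul (hB.comulOver.crossLeft hB.comulOver)
    hB.comulUnder_tensor (hB.overInv_counit.crossLeft hB.overInv_counit) hB.underInv_tensorCounit

omit hB in
theorem isCoalgHom_assoc : IsCoalgHom
    (twistComul (braid21 β) (tensorComul β) (Coalgebra.comul (R := ℂ) (A := B)))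
    (prodForm (tensorCounit B) Coalgebra.counit)
    (twistComul (braid12 β) (Coalgebra.comul (R := ℂ) (A := B)) (tensorComul β))
    (prodForm Coalgebra.counit (tensorCounit B))
    (TensorProduct.assoc ℂ B B B).toLinearMap where
  comul := twistComul_assoc β _
  counit := TensorProduct.ext_threefold fun a b c => by
    simp [tensorCounit, mul_assoc]

theorem convExp_compatible {ψ E : B ⊗[ℂ] B →ₗ[ℂ] ℂ} (hψ : FormCompatible β ψ)
    (hE : IsConvExp (tensorComul β) (tensorCounit B) ψ E) : FormCompatible β E := by
  rw [formCompatible_iff] at hψ ⊢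
  exact ⟨OverInv.convExp hB.comulOver_tensor hB.overInv_tensorCounit hψ.1 hE,
    UnderInv.convExp hB.comulUnder_tensor hB.underInv_tensorCounit hψ.2 hE⟩

theorem mulCompatible_mulConv {E : B ⊗[ℂ] B →ₗ[ℂ] ℂ} (hE : FormCompatible β E) :
    MulCompatible β (mulConv β E) := by
  rw [formCompatible_iff] at hE
  rw [mulConv_eq]
  exact hB.algebra.mul_compatible.comp
    ⟨hB.comulOver_tensor.map_actR hE.1, hB.comulUnder_tensor.map_actR hE.2⟩

/-- Associativity of `μ ⋆ e^ψ` for a commuting cocycle `ψ`: both sides of the associativity law are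
`μ⁽³⁾ ⋆ e^χ` with `χ = ψ ∘ (μ ⊗ id) + ψ ⊗ δ` and `χ = ψ ∘ (id ⊗ μ) + δ ⊗ ψ` respectively. -/
theorem mulConv_assoc {ψ E : B ⊗[ℂ] B →ₗ[ℂ] ℂ} (hψ : FormCompatible β ψ)
    (hcomm : convMul β ψ = mulConv β ψ) (hcob : coboundary ψ = 0)
    (hE : IsConvExp (tensorComul β) (tensorCounit B) ψ E) :
    mulConv β E ∘ₗ TensorProduct.map (mulConv β E) LinearMap.id =
      mulConv β E ∘ₗ TensorProduct.map LinearMap.id (mulConv β E) ∘ₗ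
        (TensorProduct.assoc ℂ B B B).toLinearMap := by
  have hEc := formCompatible_iff.1 (hB.convExp_compatible hψ hE)
  rw [formCompatible_iff] at hψ
  rw [convMul_eq, mulConv_eq] at hcomm
  rw [mulConv_eq]
  set μ := LinearMap.mul' ℂ B
  set Λ := tensorComul β
  set Δ := Coalgebra.comul (R := ℂ) (A := B)
  set δ := Coalgebra.counit (R := ℂ) (A := B)
  set a := (TensorProduct.assoc ℂ B B B).toLinearMap with ha
  set D := twistComul (braid21 β) Λ Δ with hD
  set D' := twistComul (braid12 β) Δ Λ with hD'
  set m₁ : (B ⊗[ℂ] B) ⊗[ℂ] B →ₗ[ℂ] B ⊗[ℂ] B := TensorProduct.map μ LinearMap.id with hm₁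
  set m₂ : B ⊗[ℂ] (B ⊗[ℂ] B) →ₗ[ℂ] B ⊗[ℂ] B := TensorProduct.map LinearMap.id μ with hm₂
  have hover : OverInv (braid21 β) δ := hB.overInv_counit.crossLeft hB.overInv_counit
  have hunder : UnderInv (braid12 β) δ := hB.underInv_counit.crossRight hB.underInv_counit
  have hD₃ : IsCoalg D (prodForm (tensorCounit B) δ) := hB.isCoalg_triple
  have hom₁ : IsCoalgHom D _ Λ _ m₁ := hB.isCoalgHom_mul_id
  have hom₂ : IsCoalgHom D' _ Λ _ m₂ := hB.isCoalgHom_id_mul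
  have homa : IsCoalgHom D _ D' _ a := isCoalgHom_assoc (β := β)
  have homp : IsCoalgHom D _ Λ (tensorCounit B) (contrR δ) :=
    isCoalg_comul.isCoalgHom_contrR hover Λ (tensorCounit B)
  have homq : IsCoalgHom D' _ Λ (tensorCounit B) (contrL δ) :=
    isCoalg_comul.isCoalgHom_contrL hunder Λ (tensorCounit B)
  have eqp (f : B ⊗[ℂ] B →ₗ[ℂ] ℂ) : f ∘ₗ contrR δ = prodForm f δ :=
    LinearMap.ext fun z => apply_contrR _ _ z
  have eqq (f : B ⊗[ℂ] B →ₗ[ℂ] ℂ) : f ∘ₗ contrL δ = prodForm δ f :=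
    LinearMap.ext fun z => apply_contrL _ _ z
  -- The functionals `f ⊗ δ` and `δ ⊗ f` act on one pair of neighbouring factors only.
  have Rp {f : B ⊗[ℂ] B →ₗ[ℂ] ℂ} (hf : UnderInv (braid21 β) f) :
      actR D (f ∘ₗ contrR δ) = TensorProduct.map (actR Λ f) LinearMap.id := by
    rw [eqp, hD, actR_twistComul hf, isCoalg_comul.counit_right]
  have Lp (f : B ⊗[ℂ] B →ₗ[ℂ] ℂ) :
      actL D (f ∘ₗ contrR δ) = TensorProduct.map (actL Λ f) LinearMap.id := by
    rw [eqp, hD, actL_twistComul hover, isCoalg_comul.counit_left]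
  have Rq (f : B ⊗[ℂ] B →ₗ[ℂ] ℂ) :
      actR D' (f ∘ₗ contrL δ) = TensorProduct.map LinearMap.id (actR Λ f) := by
    rw [eqq, hD', actR_twistComul hunder, isCoalg_comul.counit_right]
  have Lq {f : B ⊗[ℂ] B →ₗ[ℂ] ℂ} (hf : OverInv (braid12 β) f) :
      actL D' (f ∘ₗ contrL δ) = TensorProduct.map LinearMap.id (actL Λ f) := by
    rw [eqq, hD', actL_twistComul hf, isCoalg_comul.counit_left]
  have m₁map (T : B ⊗[ℂ] B →ₗ[ℂ] B ⊗[ℂ] B) :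
      m₁ ∘ₗ TensorProduct.map T LinearMap.id = TensorProduct.map (μ ∘ₗ T) LinearMap.id := by
    rw [hm₁, ← TensorProduct.map_comp, LinearMap.id_comp]
  have m₂map (T : B ⊗[ℂ] B →ₗ[ℂ] B ⊗[ℂ] B) :
      m₂ ∘ₗ TensorProduct.map LinearMap.id T = TensorProduct.map LinearMap.id (μ ∘ₗ T) := by
    rw [hm₂, ← TensorProduct.map_comp, LinearMap.id_comp]
  -- Both convolutions are values of `ψ` on `(μ ∘ act ψ) ⊗ id`, and the two actions of `ψ` agree under `μ`.
  have comm₁ : prodForm (ψ ∘ₗ m₁) (ψ ∘ₗ contrR δ) ∘ₗ D =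
      prodForm (ψ ∘ₗ contrR δ) (ψ ∘ₗ m₁) ∘ₗ D := by
    rw [prodForm_comp_eq_actR, prodForm_comp_eq_actL, Rp hψ.2, Lp, LinearMap.comp_assoc,
      LinearMap.comp_assoc, m₁map, m₁map, hcomm]
  have comm₂ : prodForm (ψ ∘ₗ m₂) (ψ ∘ₗ contrL δ) ∘ₗ D' =
      prodForm (ψ ∘ₗ contrL δ) (ψ ∘ₗ m₂) ∘ₗ D' := by
    rw [prodForm_comp_eq_actR, prodForm_comp_eq_actL, Rq, Lq hψ.1, LinearMap.comp_assoc,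
      LinearMap.comp_assoc, m₂map, m₂map, hcomm]
  -- The cocycle condition.
  have hχ : ψ ∘ₗ m₁ + ψ ∘ₗ contrR δ = (ψ ∘ₗ m₂) ∘ₗ a + (ψ ∘ₗ contrL δ) ∘ₗ a := by
    have h : (ψ ∘ₗ contrL δ) ∘ₗ a - ψ ∘ₗ m₁ + (ψ ∘ₗ m₂) ∘ₗ a - ψ ∘ₗ contrR δ = 0 := by
      rw [eqp, eqq]
      exact hcob
    rw [← sub_eq_zero, ← neg_eq_zero, ← h]
    abel
  have hexp : prodForm (E ∘ₗ m₁) (E ∘ₗ contrR δ) ∘ₗ D =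
      prodForm ((E ∘ₗ m₂) ∘ₗ a) ((E ∘ₗ contrL δ) ∘ₗ a) ∘ₗ D := by
    refine (hD₃.isConvExp_add (hom₁.isConvExp_comp hE) (homp.isConvExp_comp hE) comm₁).unique ?_
    rw [hχ]
    refine hD₃.isConvExp_add (homa.isConvExp_comp (hom₂.isConvExp_comp hE))
      (homa.isConvExp_comp (homq.isConvExp_comp hE)) ?_
    rw [homa.prodForm_comp, homa.prodForm_comp, comm₂]
  have hμ : μ ∘ₗ m₁ = (μ ∘ₗ m₂) ∘ₗ a := TensorProduct.ext_threefold fun x y z => by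
    simp [μ, m₁, m₂, a, mul_assoc]
  calc _ = μ ∘ₗ (actR Λ E ∘ₗ m₁) ∘ₗ TensorProduct.map (actR Λ E) LinearMap.id := by
        rw [LinearMap.comp_assoc, LinearMap.comp_assoc, m₁map]
    _ = (μ ∘ₗ m₁) ∘ₗ actR D (E ∘ₗ m₁) ∘ₗ actR D (E ∘ₗ contrR δ) := by
        rw [hom₁.actR_comp, Rp hEc.2, LinearMap.comp_assoc, LinearMap.comp_assoc]
    _ = (μ ∘ₗ m₁) ∘ₗ actR D (prodForm (E ∘ₗ m₁) (E ∘ₗ contrR δ) ∘ₗ D) := by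
        rw [prodForm_comp_eq_actR, hD₃.coassoc.actR_comp]
    _ = (μ ∘ₗ m₂) ∘ₗ a ∘ₗ actR D ((E ∘ₗ m₂) ∘ₗ a) ∘ₗ actR D ((E ∘ₗ contrL δ) ∘ₗ a) := by
        rw [hexp, hμ, prodForm_comp_eq_actR, hD₃.coassoc.actR_comp, LinearMap.comp_assoc]
    _ = (μ ∘ₗ m₂) ∘ₗ actR D' (E ∘ₗ m₂) ∘ₗ actR D' (E ∘ₗ contrL δ) ∘ₗ a := by
        rw [homa.actR_comp (E ∘ₗ contrL δ), ← LinearMap.comp_assoc _ _ a,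
          ← homa.actR_comp (E ∘ₗ m₂)]
        rfl
    _ = μ ∘ₗ (actR Λ E ∘ₗ m₂) ∘ₗ TensorProduct.map LinearMap.id (actR Λ E) ∘ₗ a := by
        rw [hom₂.actR_comp, Rq, LinearMap.comp_assoc, LinearMap.comp_assoc]
    _ = _ := by
        rw [LinearMap.comp_assoc, LinearMap.comp_assoc, ← LinearMap.comp_assoc a, m₂map]

end IsBraidedBialgebra

end Deformation

/-! ### Deformations generated by a cocycle -/

section Deformation

variable {B : Type u} [Ring B] [Algebra ℂ B] [Coalgebra ℂ B] {β : B ⊗[ℂ] B ≃ₗ[ℂ] B ⊗[ℂ] B}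

namespace IsBraidedBialgebra

variable (hB : IsBraidedBialgebra β)
include hB

theorem braid_tmul_one (b : B) : β (b ⊗ₜ 1) = 1 ⊗ₜ b := by
  have h := LinearMap.congr_fun hB.algebra.unit_compatible.invariant (b ⊗ₜ (1 : ℂ))
  simpa [braid10] using h.symm

theorem braid_one_tmul (b : B) : β (1 ⊗ₜ b) = b ⊗ₜ 1 := by
  have h := LinearMap.congr_fun hB.algebra.unit_compatible.inv_invariant ((1 : ℂ) ⊗ₜ b)
  simpa [braid01] using h.symm

theorem isCoalgHom_one_tmul : IsCoalgHom (Coalgebra.comul (R := ℂ) (A := B)) Coalgebra.counit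
    (tensorComul β) (tensorCounit B) (TensorProduct.mk ℂ B B 1) where
  comul := LinearMap.ext fun b => by
    have key (t : B ⊗[ℂ] B) : braidMid β ((1 ⊗ₜ 1) ⊗ₜ t) =
        TensorProduct.map (TensorProduct.mk ℂ B B 1) (TensorProduct.mk ℂ B B 1) t := by
      induction t with
      | zero => simp
      | tmul p q => simp [braidMid, braidFst, hB.braid_one_tmul]
      | add x y hx hy => rw [TensorProduct.tmul_add, map_add, map_add, hx, hy]
    simpa [tensorComul, hB.comul_one] using key (Coalgebra.comul b)
  counit := LinearMap.ext fun b => by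
    simp [tensorCounit, hB.counit_one]

theorem isCoalgHom_tmul_one : IsCoalgHom (Coalgebra.comul (R := ℂ) (A := B)) Coalgebra.counit
    (tensorComul β) (tensorCounit B) ((TensorProduct.mk ℂ B B).flip 1) where
  comul := LinearMap.ext fun b => by
    have key (t : B ⊗[ℂ] B) : braidMid β (t ⊗ₜ (1 ⊗ₜ 1)) =
        TensorProduct.map ((TensorProduct.mk ℂ B B).flip 1) ((TensorProduct.mk ℂ B B).flip 1) t := by
      induction t with
      | zero => simp
      | tmul p q => simp [braidMid, braidFst, hB.braid_tmul_one]
      | add x y hx hy => rw [TensorProduct.add_tmul, map_add, map_add, hx, hy]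
    simpa [tensorComul, hB.comul_one] using key (Coalgebra.comul b)
  counit := LinearMap.ext fun b => by
    simp [tensorCounit, hB.counit_one]

omit hB in
/-- If `ψ` vanishes on the image of the coalgebra homomorphism `ι`, then `μ ⋆ e^ψ` agrees with `μ`
on this image. -/
theorem mulConv_comp_of_comp_eq_zero {ψ E : B ⊗[ℂ] B →ₗ[ℂ] ℂ}
    (hE : IsConvExp (tensorComul β) (tensorCounit B) ψ E) {ι : B →ₗ[ℂ] B ⊗[ℂ] B}
    (hι : IsCoalgHom (Coalgebra.comul (R := ℂ) (A := B)) Coalgebra.counit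
      (tensorComul β) (tensorCounit B) ι) (h : ψ ∘ₗ ι = 0) :
    mulConv β E ∘ₗ ι = LinearMap.mul' ℂ B ∘ₗ ι := by
  have h₁ := hι.isConvExp_comp hE
  rw [h] at h₁
  rw [mulConv_eq, LinearMap.comp_assoc, hι.actR_comp, h₁.unique isCoalg_comul.isConvExp_zero,
    isCoalg_comul.counit_right, LinearMap.comp_id]

/-- Evaluating the cocycle condition on `1 ⊗ 1 ⊗ b`. -/
theorem apply_one_tmul_of_coboundary {ψ : B ⊗[ℂ] B →ₗ[ℂ] ℂ} (h₁ : ψ (1 ⊗ₜ 1) = 0)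
    (h : coboundary ψ = 0) (b : B) : ψ (1 ⊗ₜ b) = 0 := by
  have := LinearMap.congr_fun h ((1 ⊗ₜ 1) ⊗ₜ b)
  simpa [coboundary, hB.counit_one, h₁] using this

/-- Evaluating the cocycle condition on `b ⊗ 1 ⊗ 1`. -/
theorem apply_tmul_one_of_coboundary {ψ : B ⊗[ℂ] B →ₗ[ℂ] ℂ} (h₁ : ψ (1 ⊗ₜ 1) = 0)
    (h : coboundary ψ = 0) (b : B) : ψ (b ⊗ₜ 1) = 0 := by
  have := LinearMap.congr_fun h ((b ⊗ₜ 1) ⊗ₜ 1)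
  simpa [coboundary, hB.counit_one, h₁] using this

theorem isBraidedAlgebra_mulConv {ψ E : B ⊗[ℂ] B →ₗ[ℂ] ℂ} (hψ : FormCompatible β ψ)
    (hcomm : convMul β ψ = mulConv β ψ) (h₁ : ψ (1 ⊗ₜ 1) = 0) (hcob : coboundary ψ = 0)
    (hE : IsConvExp (tensorComul β) (tensorCounit B) ψ E) :
    IsBraidedAlgebra β (mulConv β E) 1 where
  braiding := hB.algebra.braiding
  assoc a b c := LinearMap.congr_fun (hB.mulConv_assoc hψ hcomm hcob hE) ((a ⊗ₜ b) ⊗ₜ c)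
  one_mul a := by
    have h := mulConv_comp_of_comp_eq_zero hE hB.isCoalgHom_one_tmul
      (LinearMap.ext (hB.apply_one_tmul_of_coboundary h₁ hcob))
    simpa using LinearMap.congr_fun h a
  mul_one a := by
    have h := mulConv_comp_of_comp_eq_zero hE hB.isCoalgHom_tmul_one
      (LinearMap.ext (hB.apply_tmul_one_of_coboundary h₁ hcob))
    simpa using LinearMap.congr_fun h a
  mul_compatible := hB.mulCompatible_mulConv (hB.convExp_compatible hψ hE)
  unit_compatible := hB.algebra.unit_compatible

/-- Commutation with `μ` passes to the exponential. -/
theorem convMul_convExp {ψ E : B ⊗[ℂ] B →ₗ[ℂ] ℂ} (hcomm : convMul β ψ = mulConv β ψ)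
    (hE : IsConvExp (tensorComul β) (tensorCounit B) ψ E) : convMul β E = mulConv β E := by
  have hΛ := hB.isCoalg_tensor
  rw [convMul_eq, mulConv_eq] at hcomm ⊢
  set Λ := tensorComul β
  set μ := LinearMap.mul' ℂ B
  have hpow (n : ℕ) : μ ∘ₗ actL Λ (convPow Λ (tensorCounit B) ψ n) =
      μ ∘ₗ actR Λ (convPow Λ (tensorCounit B) ψ n) := by
    induction n with
    | zero =>
      rw [convPow, hΛ.counit_left, hΛ.counit_right]
    | succ n ih =>
      rw [convPow_succ]
      conv_lhs => rw [prodForm_comp_eq_actL, hΛ.coassoc.actL_comp, ← LinearMap.comp_assoc, hcomm,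
        LinearMap.comp_assoc, ← hΛ.coassoc.actL_actR, ← LinearMap.comp_assoc, ih,
        LinearMap.comp_assoc, ← hΛ.coassoc.actR_comp, ← prodForm_comp_eq_actR]
  refine LinearMap.ext fun x => sub_eq_zero.1
    ((Module.forall_dual_apply_eq_zero_iff ℂ _).1 fun χ => ?_)
  have hl (f : B ⊗[ℂ] B →ₗ[ℂ] ℂ) : χ (μ (actL Λ f x)) = f (contrR (χ ∘ₗ μ) (Λ x)) := by
    rw [apply_contrR, ← apply_contrL]; rfl
  have hr (f : B ⊗[ℂ] B →ₗ[ℂ] ℂ) : χ (μ (actR Λ f x)) = f (contrL (χ ∘ₗ μ) (Λ x)) := by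
    rw [apply_contrL, ← apply_contrR]; rfl
  rw [map_sub, sub_eq_zero, LinearMap.comp_apply, LinearMap.comp_apply, hl, hr]
  refine (hE _).unique ?_
  have hn (n : ℕ) : convPow Λ (tensorCounit B) ψ n (contrL (χ ∘ₗ μ) (Λ x)) =
      convPow Λ (tensorCounit B) ψ n (contrR (χ ∘ₗ μ) (Λ x)) := by
    rw [← hl, ← hr]
    exact congrArg χ (LinearMap.congr_fun (hpow n) x).symm
  simp_rw [← hn]
  exact hE _

/-- If `E` commutes with `μ`, then `Δ ∘ (μ ⋆ (E ⋆ F)) = ((μ ⋆ E) ⊗ (μ ⋆ F)) ∘ Λ`. Coassociativity moves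
`E` to the middle leg of `Λ`, where commutation turns its right action into a left one. -/
theorem comul_mulConv {E F : B ⊗[ℂ] B →ₗ[ℂ] ℂ} (hE : convMul β E = mulConv β E) :
    Coalgebra.comul (R := ℂ) (A := B) ∘ₗ mulConv β (prodForm E F ∘ₗ tensorComul β) =
      TensorProduct.map (mulConv β E) (mulConv β F) ∘ₗ tensorComul β := by
  have hΛ := hB.isCoalg_tensor.coassoc
  have hm : Coalgebra.comul (R := ℂ) (A := B) ∘ₗ LinearMap.mul' ℂ B =
      TensorProduct.map (LinearMap.mul' ℂ B) (LinearMap.mul' ℂ B) ∘ₗ tensorComul β := hB.comul_mul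
  rw [convMul_eq, mulConv_eq] at hE
  simp only [mulConv_eq]
  set Λ := tensorComul β
  set μ := LinearMap.mul' ℂ B
  have h (S T : B ⊗[ℂ] B →ₗ[ℂ] B ⊗[ℂ] B) : TensorProduct.map (μ ∘ₗ S) (μ ∘ₗ T) =
      TensorProduct.map μ μ ∘ₗ TensorProduct.map S T := TensorProduct.map_comp _ _ _ _
  calc _ = TensorProduct.map μ μ ∘ₗ (Λ ∘ₗ actR Λ E) ∘ₗ actR Λ F := by
        rw [← LinearMap.comp_assoc, hm, prodForm_comp_eq_actR, hΛ.actR_comp, LinearMap.comp_assoc,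
          LinearMap.comp_assoc]
    _ = (TensorProduct.map (μ ∘ₗ LinearMap.id) (μ ∘ₗ actR Λ E) ∘ₗ Λ) ∘ₗ actR Λ F := by
        rw [hΛ.comul_actR, h]; rfl
    _ = TensorProduct.map μ μ ∘ₗ (TensorProduct.map (actR Λ E) LinearMap.id ∘ₗ Λ) ∘ₗ
        actR Λ F := by
        rw [← hE, h, hΛ.map_actR_id]; rfl
    _ = (TensorProduct.map μ μ ∘ₗ TensorProduct.map (actR Λ E) LinearMap.id ∘ₗ
        TensorProduct.map LinearMap.id (actR Λ F)) ∘ₗ Λ := by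
        rw [LinearMap.comp_assoc, hΛ.comul_actR]; rfl
    _ = _ := by
        rw [← TensorProduct.map_comp, h, LinearMap.comp_id, LinearMap.id_comp]

theorem counit_comp_mulConv (E : B ⊗[ℂ] B →ₗ[ℂ] ℂ) :
    Coalgebra.counit (R := ℂ) (A := B) ∘ₗ mulConv β E = E := by
  rw [mulConv_eq, ← LinearMap.comp_assoc, hB.counit_mul, ← prodForm_comp_eq_actR,
    prodForm_comp_eq_actL, hB.isCoalg_tensor.counit_left, LinearMap.comp_id]

omit hB [Coalgebra ℂ B] in
theorem formCompatible_smul {L : B ⊗[ℂ] B →ₗ[ℂ] ℂ} (h : FormCompatible β L) (t : ℂ) :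
    FormCompatible β (t • L) := by
  rw [formCompatible_iff, overInv_iff, underInv_iff] at h ⊢
  exact ⟨fun χ z => congrArg (t * ·) (h.1 χ z), fun χ z => congrArg (t * ·) (h.2 χ z)⟩

omit hB in
theorem mulConv_smul (t : ℂ) (L : B ⊗[ℂ] B →ₗ[ℂ] ℂ) : mulConv β (t • L) = t • mulConv β L := by
  simp only [mulConv, conv, TensorProduct.map_smul_right, LinearMap.smul_comp, LinearMap.comp_smul]

omit hB in
theorem convMul_smul (t : ℂ) (L : B ⊗[ℂ] B →ₗ[ℂ] ℂ) : convMul β (t • L) = t • convMul β L := by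
  simp only [convMul, conv, TensorProduct.map_smul_left, LinearMap.smul_comp, LinearMap.comp_smul]

omit hB in
theorem coboundary_smul (t : ℂ) (L : B ⊗[ℂ] B →ₗ[ℂ] ℂ) :
    coboundary (t • L) = t • coboundary L := by
  simp only [coboundary, TensorProduct.map_smul_left, TensorProduct.map_smul_right,
    LinearMap.smul_comp, LinearMap.comp_smul, smul_sub, smul_add]

/-- A commuting normalised compatible cocycle generates an additive deformation. -/
theorem isAdditiveDeformation_mulConv {L : B ⊗[ℂ] B →ₗ[ℂ] ℂ} (hL : FormCompatible β L)
    (hcomm : convMul β L = mulConv β L) (h₁ : L (1 ⊗ₜ 1) = 0) (hcob : coboundary L = 0)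
    {E : ℝ → (B ⊗[ℂ] B →ₗ[ℂ] ℂ)} (hE : ∀ t, IsFormExp β L t (E t)) :
    IsAdditiveDeformation β (fun t => mulConv β (E t)) where
  zero := by
    have h := hE 0
    rw [IsFormExp, Complex.ofReal_zero, zero_smul] at h
    rw [h.unique hB.isCoalg_tensor.isConvExp_zero, mulConv_eq, hB.isCoalg_tensor.counit_right,
      LinearMap.comp_id]
  algebra t := hB.isBraidedAlgebra_mulConv (formCompatible_smul hL t)
    (by rw [convMul_smul, mulConv_smul, hcomm]) (by simp [h₁])
    (by rw [coboundary_smul, hcob, smul_zero]) (hE t)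
  comul t s := by
    rw [hB.isCoalg_tensor.convExp_add hE, hB.comul_mulConv]
    exact hB.convMul_convExp (by rw [convMul_smul, mulConv_smul, hcomm]) (hE t)
  counit x := by
    have h (t : ℝ) : Coalgebra.counit (R := ℂ) (mulConv β (E t) x) = E t x :=
      LinearMap.congr_fun (hB.counit_comp_mulConv (E t)) x
    simp_rw [h]
    exact hB.isCoalg_tensor.tendsto_convExp hE x

end IsBraidedBialgebra

end Deformation

/-! ### Involutions -/

section Star

variable {B : Type u} [Ring B] [Algebra ℂ B] [StarRing B] [StarModule ℂ B]

/-- The antilinear map `a ⊗ b ↦ b* ⊗ a*` on `B ⊗ B`. -/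
def flipStar (B : Type u) [Ring B] [Algebra ℂ B] [StarRing B] [StarModule ℂ B] :
    B ⊗[ℂ] B →ₗ⋆[ℂ] B ⊗[ℂ] B :=
  (TensorProduct.map (starLinearEquiv ℂ (A := B)).toLinearMap
    (starLinearEquiv ℂ (A := B)).toLinearMap) ∘ₛₗ (TensorProduct.comm ℂ B B).toLinearMap

@[simp]
theorem flipStar_tmul (a b : B) : flipStar B (a ⊗ₜ b) = star b ⊗ₜ star a := rfl

theorem flipStar_flipStar (x : B ⊗[ℂ] B) : flipStar B (flipStar B x) = x := by
  induction x with
  | zero => simp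
  | tmul a b => simp
  | add x y hx hy => rw [map_add, map_add, hx, hy]

theorem mul_flipStar (x : B ⊗[ℂ] B) :
    LinearMap.mul' ℂ B (flipStar B x) = star (LinearMap.mul' ℂ B x) := by
  induction x with
  | zero => simp
  | tmul a b => simp
  | add x y hx hy => rw [map_add, map_add, map_add, star_add, hx, hy]

/-- The functional `x ↦ conj (f (x^κ))`, where `κ` is `flipStar`. -/
def conjForm (f : B ⊗[ℂ] B →ₗ[ℂ] ℂ) : B ⊗[ℂ] B →ₗ[ℂ] ℂ where
  toFun x := conj (f (flipStar B x))
  map_add' x y := by simp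
  map_smul' r x := by simp

theorem conjForm_apply (f : B ⊗[ℂ] B →ₗ[ℂ] ℂ) (x : B ⊗[ℂ] B) :
    conjForm f x = conj (f (flipStar B x)) := rfl

theorem hermitianForm_iff {f : B ⊗[ℂ] B →ₗ[ℂ] ℂ} : HermitianForm f ↔ conjForm f = f := by
  constructor
  · intro h
    ext a b
    simpa [conjForm] using h (star b) (star a)
  · intro h a b
    have := LinearMap.congr_fun h (star b ⊗ₜ star a)
    simpa [conjForm] using this

variable [Coalgebra ℂ B] {β : B ⊗[ℂ] B ≃ₗ[ℂ] B ⊗[ℂ] B}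

omit [StarRing B] [StarModule ℂ B] [Coalgebra ℂ B] in
/-- A functional that can be pulled through the braiding absorbs a crossing of `B ⊗ B` with
itself. -/
theorem contrR_midMap_map {E : B ⊗[ℂ] B →ₗ[ℂ] ℂ} (hE : UnderInv (braid21 β) E)
    (z : (B ⊗[ℂ] B) ⊗[ℂ] (B ⊗[ℂ] B)) :
    contrR E (midMap β.toLinearMap (TensorProduct.map β.toLinearMap β.toLinearMap z)) =
      contrL E (midMap β.symm.toLinearMap z) := by
  have hinv (z : (B ⊗[ℂ] B) ⊗[ℂ] (B ⊗[ℂ] B)) :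
      midMap β.toLinearMap (midMap β.symm.toLinearMap z) = z := by
    suffices h : midMap (W := B) (Z := B) β.toLinearMap ∘ₗ midMap β.symm.toLinearMap =
      LinearMap.id from LinearMap.congr_fun h z
    refine TensorProduct.ext_fourfold' fun w x y z => ?_
    have key (t : B ⊗[ℂ] B) : midMap β.toLinearMap ((TensorProduct.assoc ℂ B B (B ⊗[ℂ] B)).symm
        (w ⊗ₜ TensorProduct.assoc ℂ B B B (t ⊗ₜ z))) =
        (TensorProduct.assoc ℂ B B (B ⊗[ℂ] B)).symm
          (w ⊗ₜ TensorProduct.assoc ℂ B B B (β t ⊗ₜ z)) := by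
      induction t with
      | zero => simp
      | tmul p q => simp [midMap]
      | add s t hs ht =>
        simp only [TensorProduct.add_tmul, map_add, TensorProduct.tmul_add, hs, ht]
    refine (key (β.symm (x ⊗ₜ y))).trans ?_
    simp
  have h : UnderInv (crossRight (braid21 β) (braid21 β)) E := hE.crossRight hE
  rw [← midMap_map_midMap] at h
  have h' := LinearMap.congr_fun h (midMap β.symm.toLinearMap z)
  simpa [hinv] using h'

/-- The involution of `B ⊗ B` is forced to be `β ∘ κ`, where `κ` is `flipStar`, because
`a ⊗ b = (a ⊗ 1)(1 ⊗ b)`. Being an involution, it gives `κ ∘ β = β⁻¹ ∘ κ`; being compatible with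
`Δ`, it gives `β ∘ κ ∘ Δ = Δ ∘ *`. -/
theorem IsBraidedStarBialgebra.flipStar_braid_and_comul (hB : IsBraidedStarBialgebra β) :
    (∀ x, flipStar B (β x) = β.symm (flipStar B x)) ∧
      ∀ a : B, β (flipStar B (Coalgebra.comul a)) = Coalgebra.comul (R := ℂ) (star a) := by
  obtain ⟨J, hJ, hJm, hJl, hJr, hJΔ⟩ := hB.exists_star
  have h₁ (a b : B) : tensorMul β ((a ⊗ₜ 1) ⊗ₜ (1 ⊗ₜ b)) = a ⊗ₜ b := by
    simp [tensorMul, braidMid, braidFst, hB.bialgebra.braid_one_tmul]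
  -- The product `(1 ⊗ a)(b ⊗ 1)` is `β (a ⊗ b)`.
  have h₂ (a b : B) : tensorMul β ((1 ⊗ₜ a) ⊗ₜ (b ⊗ₜ 1)) = β (a ⊗ₜ b) := by
    have key (t : B ⊗[ℂ] B) :
        TensorProduct.map (LinearMap.mul' ℂ B) (LinearMap.mul' ℂ B)
          ((TensorProduct.assoc ℂ B B (B ⊗[ℂ] B)).symm
            ((1 : B) ⊗ₜ TensorProduct.assoc ℂ B B B (t ⊗ₜ (1 : B)))) = t := by
      induction t with
      | zero => simp
      | tmul p q => simp
      | add s t hs ht =>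
        simp only [TensorProduct.add_tmul, map_add, TensorProduct.tmul_add, hs, ht]
    exact key (β (a ⊗ₜ b))
  have hJκ (x : B ⊗[ℂ] B) : J x = β (flipStar B x) := by
    induction x with
    | zero => simp
    | tmul a b => rw [← h₁ a b, hJm, hJl, hJr, h₂, h₁, flipStar_tmul]
    | add x y hx hy => rw [map_add, map_add, map_add, hx, hy]
  refine ⟨fun x => ?_, fun a => by rw [← hJκ, hJΔ]⟩
  have h := hJ (flipStar B x)
  rw [hJκ, hJκ, flipStar_flipStar] at h
  rw [← h, LinearEquiv.symm_apply_apply]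

/-- The counit of a braided `*`-bialgebra is a `*`-homomorphism. -/
theorem IsBraidedStarBialgebra.counit_star (hB : IsBraidedStarBialgebra β) (a : B) :
    Coalgebra.counit (R := ℂ) (star a) = conj (Coalgebra.counit (R := ℂ) a) := by
  have hu := hB.bialgebra.underInv_counit
  set δ := Coalgebra.counit (R := ℂ) (A := B)
  -- `δ'` is a right counit, hence equal to `δ`
  let δ' : B →ₗ[ℂ] ℂ :=
    { toFun := fun b => conj (δ (star b))
      map_add' := fun x y => by simp
      map_smul' := fun r x => by simp }
  have key (x : B ⊗[ℂ] B) : contrR δ (β (flipStar B x)) = star (contrR δ' x) := by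
    induction x with
    | zero => simp
    | tmul p q =>
      have := hu.apply (star q) (star p)
      rw [LinearEquiv.coe_coe] at this
      simp [this, δ']
    | add x y hx hy => rw [map_add, map_add, map_add, map_add, star_add, hx, hy]
  have hΔ := LinearMap.congr_fun (isCoalg_comul (B := B)).counit_right
  have h : contrR δ' (Coalgebra.comul a) = a := by
    apply star_injective
    rw [← key, hB.flipStar_braid_and_comul.2]
    exact hΔ (star a)
  have h' : δ' a = δ a := by
    conv_rhs => rw [← h, apply_contrR, ← apply_contrL]
    exact (congrArg δ' (LinearMap.congr_fun (isCoalg_comul (B := B)).counit_left a)).symm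
  rw [← h']
  simp [δ']

/-- The right action of a functional passing through the braiding is intertwined by `flipStar` with the
right action of its conjugate. -/
theorem IsBraidedStarBialgebra.actR_flipStar (hB : IsBraidedStarBialgebra β)
    {E : B ⊗[ℂ] B →ₗ[ℂ] ℂ} (hE : UnderInv (braid21 β) E) (x : B ⊗[ℂ] B) :
    actR (tensorComul β) E (flipStar B x) =
      flipStar B (actR (tensorComul β) (conjForm E) x) := by
  obtain ⟨hβ, hΔ⟩ := hB.flipStar_braid_and_comul
  have key (s t : B ⊗[ℂ] B) :
      contrL E (midMap β.symm.toLinearMap (flipStar B t ⊗ₜ flipStar B s)) =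
        flipStar B (contrR (conjForm E) (midMap β.toLinearMap (s ⊗ₜ t))) := by
    induction s with
    | zero => simp
    | add s s' hs hs' =>
      simp only [map_add, TensorProduct.add_tmul, TensorProduct.tmul_add, hs, hs']
    | tmul p q =>
      induction t with
      | zero => simp
      | add t t' ht ht' =>
        simp only [map_add, TensorProduct.add_tmul, TensorProduct.tmul_add, ht, ht']
      | tmul r s =>
        have h (t : B ⊗[ℂ] B) : contrL E ((TensorProduct.assoc ℂ B B (B ⊗[ℂ] B)).symm
            (star s ⊗ₜ TensorProduct.assoc ℂ B B B (flipStar B t ⊗ₜ star p))) =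
            flipStar B (contrR (conjForm E) ((TensorProduct.assoc ℂ B B (B ⊗[ℂ] B)).symm
              (p ⊗ₜ TensorProduct.assoc ℂ B B B (t ⊗ₜ s)))) := by
          induction t with
          | zero => simp
          | add t t' ht ht' =>
            simp only [map_add, TensorProduct.add_tmul, TensorProduct.tmul_add, ht, ht']
          | tmul a b => simp [conjForm_apply]
        refine Eq.trans ?_ (h (β (q ⊗ₜ r)))
        rw [hβ]
        rfl
  induction x with
  | zero => simp
  | add x y hx hy => simp only [map_add, hx, hy]
  | tmul a b =>
    refine Eq.trans ?_ (key (Coalgebra.comul a) (Coalgebra.comul b))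
    rw [← contrR_midMap_map hE, TensorProduct.map_tmul, LinearEquiv.coe_coe, hΔ, hΔ]
    rfl

/-- The exponential of a hermitian functional is hermitian. -/
theorem IsBraidedStarBialgebra.conjForm_convExp (hB : IsBraidedStarBialgebra β)
    {ψ E : B ⊗[ℂ] B →ₗ[ℂ] ℂ} (hψ : UnderInv (braid21 β) ψ) (hh : conjForm ψ = ψ)
    (hE : IsConvExp (tensorComul β) (tensorCounit B) ψ E) : conjForm E = E := by
  have hpow (n : ℕ) : conjForm (convPow (tensorComul β) (tensorCounit B) ψ n) =
      convPow (tensorComul β) (tensorCounit B) ψ n := by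
    induction n with
    | zero =>
      ext a b
      simp [conjForm_apply, convPow, tensorCounit, hB.counit_star, mul_comm]
    | succ n ih =>
      rw [convPow_succ_eq_actR]
      conv_rhs => rw [← ih]
      refine LinearMap.ext fun x => ?_
      rw [conjForm_apply, LinearMap.comp_apply, LinearMap.comp_apply, hB.actR_flipStar hψ, hh,
        conjForm_apply]
  refine LinearMap.ext fun x => HasSum.unique ?_ (hE x)
  have h := (hE (flipStar B x)).map (starRingEnd ℂ) Complex.continuous_conj
  refine h.congr_fun fun n => ?_
  rw [← hpow, conjForm_apply]
  simp

theorem IsBraidedStarBialgebra.isAdditiveStarDeformation (hB : IsBraidedStarBialgebra β)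
    {L : B ⊗[ℂ] B →ₗ[ℂ] ℂ} (hL : FormCompatible β L) (hh : HermitianForm L)
    {E : ℝ → (B ⊗[ℂ] B →ₗ[ℂ] ℂ)} (hE : ∀ t, IsFormExp β L t (E t))
    (hd : IsAdditiveDeformation β (fun t => mulConv β (E t))) :
    IsAdditiveStarDeformation β (fun t => mulConv β (E t)) where
  toIsAdditiveDeformation := hd
  star_mul t a b := by
    have hc := IsBraidedBialgebra.formCompatible_smul hL (t : ℂ)
    have hEc := formCompatible_iff.1 (hB.bialgebra.convExp_compatible hc (hE t))
    have hE' : conjForm (E t) = E t := by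
      refine hB.conjForm_convExp (formCompatible_iff.1 hc).2 ?_ (hE t)
      refine LinearMap.ext fun x => ?_
      have := LinearMap.congr_fun (hermitianForm_iff.1 hh) x
      rw [conjForm_apply] at this ⊢
      simp [this]
    rw [mulConv_eq, LinearMap.comp_apply, LinearMap.comp_apply, ← mul_flipStar, ← flipStar_tmul,
      hB.actR_flipStar hEc.2, hE']

end Star

/-! ### The generator of an additive deformation -/

section Generator

variable {B : Type u} [Ring B] [Algebra ℂ B] [Coalgebra ℂ B] {β : B ⊗[ℂ] B ≃ₗ[ℂ] B ⊗[ℂ] B}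
  {μ : ℝ → (B ⊗[ℂ] B →ₗ[ℂ] B)}

namespace IsAdditiveDeformation

variable (hμ : IsAdditiveDeformation β μ)
include hμ

/-- `μ_t = μ ⋆ (δ ∘ μ_t)`: apply `id ⊗ δ` to `Δ ∘ μ_{0+t} = (μ_0 ⊗ μ_t) ∘ Λ`. -/
theorem eq_mulConv (t : ℝ) : μ t = mulConv β (Coalgebra.counit ∘ₗ μ t) := by
  have h := hμ.comul 0 t
  rw [zero_add, hμ.zero] at h
  rw [mulConv_eq, actR, ← LinearMap.comp_assoc, ← contrR_map, LinearMap.comp_assoc, ← h,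
    ← LinearMap.comp_assoc]
  exact congrArg (· ∘ₗ μ t) (isCoalg_comul (B := B)).counit_right.symm

/-- `μ_t = (δ ∘ μ_t) ⋆ μ`: apply `δ ⊗ id` to `Δ ∘ μ_{t+0} = (μ_t ⊗ μ_0) ∘ Λ`. -/
theorem eq_convMul (t : ℝ) : μ t = convMul β (Coalgebra.counit ∘ₗ μ t) := by
  have h := hμ.comul t 0
  rw [add_zero, hμ.zero] at h
  rw [convMul_eq, actL, ← LinearMap.comp_assoc, ← contrL_map, LinearMap.comp_assoc, ← h,
    ← LinearMap.comp_assoc]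
  exact congrArg (· ∘ₗ μ t) (isCoalg_comul (B := B)).counit_left.symm

/-- The functionals `δ ∘ μ_t` form a convolution group. -/
theorem counit_comp_add (s t : ℝ) : (Coalgebra.counit (R := ℂ) ∘ₗ μ (s + t)) =
    prodForm (Coalgebra.counit ∘ₗ μ s) (Coalgebra.counit ∘ₗ μ t) ∘ₗ tensorComul β := by
  have h : prodForm (Coalgebra.counit ∘ₗ μ s) (Coalgebra.counit ∘ₗ μ t) =
      prodForm (Coalgebra.counit (R := ℂ) (A := B)) Coalgebra.counit ∘ₗ
        TensorProduct.map (μ s) (μ t) := TensorProduct.ext' fun _ _ => rfl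
  rw [h, LinearMap.comp_assoc, ← hμ.comul, ← LinearMap.comp_assoc,
    (isCoalg_comul (B := B)).prodForm_counit]

theorem formCompatible_counit_comp (hB : IsBraidedBialgebra β) (t : ℝ) :
    FormCompatible β (Coalgebra.counit ∘ₗ μ t) :=
  IsCompatible.comp (show IsCompatible _ _ _ _ _ from hB.coalgebra.counit_compatible)
    (show IsCompatible _ _ _ _ _ from (hμ.algebra t).mul_compatible)

end IsAdditiveDeformation

/-- Product rule for `t ↦ F_t ∘ k ∘ (id ⊗ F_t) ∘ D` at `t = 0`. -/
theorem hasDerivAt_comp_actR {C : Type u} [AddCommGroup C] [Module ℂ C] {D : C →ₗ[ℂ] C ⊗[ℂ] C}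
    {ε L : C →ₗ[ℂ] ℂ} (h : IsCoalg D ε) {F : ℝ → (C →ₗ[ℂ] ℂ)} (h₀ : F 0 = ε)
    (hF : ∀ c, HasDerivAt (fun t => F t c) (L c) 0) {k : C →ₗ[ℂ] C} {r : ℂ}
    (hk : ∀ c, ε (k c) = r * ε c) (c : C) :
    HasDerivAt (fun t => F t (k (actR D (F t) c))) (L (k c) + r * L c) 0 := by
  have key (z : C ⊗[ℂ] C) : HasDerivAt (fun t => prodForm (F t ∘ₗ k) (F t) z)
      (prodForm (L ∘ₗ k) ε z + prodForm (ε ∘ₗ k) L z) 0 := by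
    induction z with
    | zero => simpa using hasDerivAt_const (0 : ℝ) (0 : ℂ)
    | tmul x y =>
      have h' := (hF (k x)).mul (hF y)
      rw [h₀] at h'
      exact h'
    | add x y hx hy =>
      simp only [map_add]
      rw [add_add_add_comm]
      exact hx.add hy
  have h₁ := key (D c)
  have e₁ : prodForm (L ∘ₗ k) ε (D c) = L (k c) := by
    rw [← apply_contrR]
    exact congrArg (L ∘ₗ k) (LinearMap.congr_fun h.counit_right c)
  have e₂ : prodForm (ε ∘ₗ k) L (D c) = r * L c := by
    rw [show ε ∘ₗ k = r • ε from LinearMap.ext hk, ← apply_contrR, LinearMap.smul_apply,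
      apply_contrR, ← apply_contrL, smul_eq_mul]
    exact congrArg (r * L ·) (LinearMap.congr_fun h.counit_left c)
  rw [e₁, e₂] at h₁
  refine h₁.congr_of_eventuallyEq (Eventually.of_forall fun t => ?_)
  exact apply_contrR (F t ∘ₗ k) (F t) (D c)

/-- The cocycle condition, by differentiating
`δ (μ_t (μ_t (a ⊗ b) ⊗ c)) = δ (μ_t (a ⊗ μ_t (b ⊗ c)))` at `t = 0`. -/
theorem IsAdditiveDeformation.coboundary_eq_zero (hB : IsBraidedBialgebra β)
    (hμ : IsAdditiveDeformation β μ) {L : B ⊗[ℂ] B →ₗ[ℂ] ℂ}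
    (hL : ∀ x, HasDerivAt (fun t : ℝ => Coalgebra.counit (R := ℂ) (μ t x)) (L x) 0) :
    coboundary L = 0 := by
  have h₀ : Coalgebra.counit ∘ₗ μ 0 = tensorCounit B := by rw [hμ.zero, hB.counit_mul]
  have hδ (x : B ⊗[ℂ] B) : Coalgebra.counit (R := ℂ) (LinearMap.mul' ℂ B x) = tensorCounit B x :=
    LinearMap.congr_fun hB.counit_mul x
  have hd (k : B ⊗[ℂ] B →ₗ[ℂ] B ⊗[ℂ] B) (r : ℂ)
      (hk : ∀ x, tensorCounit B (k x) = r * tensorCounit B x) (x : B ⊗[ℂ] B) :=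
    hasDerivAt_comp_actR hB.isCoalg_tensor (F := fun t => Coalgebra.counit ∘ₗ μ t) h₀ hL hk x
  have hm (t : ℝ) (x : B ⊗[ℂ] B) : LinearMap.mul' ℂ B
      (actR (tensorComul β) (Coalgebra.counit ∘ₗ μ t) x) = μ t x := by
    conv_rhs => rw [hμ.eq_mulConv, mulConv_eq]
    rfl
  refine TensorProduct.ext_threefold fun a b c => ?_
  have hk₁ (x : B ⊗[ℂ] B) :
      Coalgebra.counit (R := ℂ) (LinearMap.mul' ℂ B x) * Coalgebra.counit (R := ℂ) ((1 : ℂ) • c) =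
        Coalgebra.counit (R := ℂ) c * tensorCounit B x := by rw [hδ, one_smul, mul_comm]
  have hk₂ (x : B ⊗[ℂ] B) :
      Coalgebra.counit (R := ℂ) ((1 : ℂ) • a) * Coalgebra.counit (R := ℂ) (LinearMap.mul' ℂ B x) =
        Coalgebra.counit (R := ℂ) a * tensorCounit B x := by rw [hδ, one_smul]
  -- Since `μ_t = μ ∘ (id ⊗ F_t) ∘ Λ`, each side of the associativity law has the form treated in
  -- `hasDerivAt_comp_actR`, with `k = μ ⊗ c` on the left and `k = a ⊗ μ` on the right.
  have h₁ := hd (TensorProduct.map (LinearMap.mul' ℂ B) (LinearMap.toSpanSingleton ℂ B c) ∘ₗ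
    (TensorProduct.rid ℂ _).symm.toLinearMap) (Coalgebra.counit c)
    (fun x => hk₁ x) (a ⊗ₜ b)
  have h₂ := hd (TensorProduct.map (LinearMap.toSpanSingleton ℂ B a) (LinearMap.mul' ℂ B) ∘ₗ
    (TensorProduct.lid ℂ _).symm.toLinearMap) (Coalgebra.counit a)
    (fun x => hk₂ x) (b ⊗ₜ c)
  simp only [LinearMap.comp_apply, LinearEquiv.coe_coe, TensorProduct.rid_symm_apply,
    TensorProduct.lid_symm_apply, TensorProduct.map_tmul, LinearMap.toSpanSingleton_apply,
    one_smul, LinearMap.mul'_apply] at h₁ h₂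
  simp only [hm, (hμ.algebra _).assoc] at h₁ h₂
  have h := h₁.unique h₂
  simp only [coboundary, LinearMap.sub_apply, LinearMap.add_apply, LinearMap.comp_apply,
    LinearEquiv.coe_coe, TensorProduct.assoc_tmul, TensorProduct.map_tmul, LinearMap.id_apply,
    LinearMap.mul'_apply, TensorProduct.lid_tmul, smul_eq_mul, LinearMap.zero_apply]
  linear_combination -h

/-- `L ⋆ μ = μ ⋆ L`, by differentiating `(δ ∘ μ_t) ⋆ μ = μ ⋆ (δ ∘ μ_t)`. Linear functionals `χ` on `B`
reduce this to derivatives of the scalar functions `t ↦ δ (μ_t z)`. -/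
theorem IsAdditiveDeformation.convMul_eq_mulConv
    (hμ : IsAdditiveDeformation β μ) {L : B ⊗[ℂ] B →ₗ[ℂ] ℂ}
    (hL : ∀ x, HasDerivAt (fun t : ℝ => Coalgebra.counit (R := ℂ) (μ t x)) (L x) 0) :
    convMul β L = mulConv β L := by
  refine LinearMap.ext fun x => sub_eq_zero.1
    ((Module.forall_dual_apply_eq_zero_iff ℂ _).1 fun χ => ?_)
  have hl (f : B ⊗[ℂ] B →ₗ[ℂ] ℂ) : χ (convMul β f x) =
      f (contrR (χ ∘ₗ LinearMap.mul' ℂ B) (tensorComul β x)) := by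
    rw [apply_contrR, ← apply_contrL, convMul_eq]; rfl
  have hr (f : B ⊗[ℂ] B →ₗ[ℂ] ℂ) : χ (mulConv β f x) =
      f (contrL (χ ∘ₗ LinearMap.mul' ℂ B) (tensorComul β x)) := by
    rw [apply_contrL, ← apply_contrR, mulConv_eq]; rfl
  rw [map_sub, sub_eq_zero, hl, hr]
  refine (hL _).unique ((hL _).congr_of_eventuallyEq (Eventually.of_forall fun t => ?_))
  have h := (hr (Coalgebra.counit ∘ₗ μ t)).symm.trans (Eq.trans ?_ (hl (Coalgebra.counit ∘ₗ μ t)))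
  · exact h.symm
  · rw [← hμ.eq_mulConv, ← hμ.eq_convMul]

/-- `β`-compatibility is a family of linear equations between values of `δ ∘ μ_t`, so it passes to the
derivative. -/
theorem IsAdditiveDeformation.formCompatible_deriv (hB : IsBraidedBialgebra β)
    (hμ : IsAdditiveDeformation β μ) {L : B ⊗[ℂ] B →ₗ[ℂ] ℂ}
    (hL : ∀ x, HasDerivAt (fun t : ℝ => Coalgebra.counit (R := ℂ) (μ t x)) (L x) 0) :
    FormCompatible β L := by
  have h (t : ℝ) := formCompatible_iff.1 (hμ.formCompatible_counit_comp hB t)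
  rw [formCompatible_iff, overInv_iff, underInv_iff]
  exact ⟨fun χ z => (hL _).unique ((hL _).congr_of_eventuallyEq (Eventually.of_forall fun t =>
      overInv_iff.1 (h t).1 χ z)),
    fun χ z => (hL _).unique ((hL _).congr_of_eventuallyEq (Eventually.of_forall fun t =>
      underInv_iff.1 (h t).2 χ z))⟩

theorem IsAdditiveStarDeformation.hermitianForm_deriv [StarRing B] [StarModule ℂ B]
    (hB : IsBraidedStarBialgebra β) (hμ : IsAdditiveStarDeformation β μ)
    {L : B ⊗[ℂ] B →ₗ[ℂ] ℂ}
    (hL : ∀ x, HasDerivAt (fun t : ℝ => Coalgebra.counit (R := ℂ) (μ t x)) (L x) 0) :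
    HermitianForm L := fun a b => by
  have h : HasDerivAt (fun t : ℝ => conj (Coalgebra.counit (R := ℂ) (μ t (a ⊗ₜ b))))
      (conj (L (a ⊗ₜ b))) 0 := (hL (a ⊗ₜ b)).star
  refine h.unique ((hL _).congr_of_eventuallyEq (Eventually.of_forall fun t => ?_))
  simp only
  rw [hμ.star_mul, hB.counit_star]

end Generator

end BraidedDeformation

theorem mainTheorem2 {B : Type*} [Ring B] [Algebra ℂ B] [Coalgebra ℂ B]
    (β : B ⊗[ℂ] B ≃ₗ[ℂ] B ⊗[ℂ] B) (hB : IsBraidedBialgebra β) :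
    (∀ μ : ℝ → (B ⊗[ℂ] B →ₗ[ℂ] B), IsAdditiveDeformation β μ →
      ∃ L : B ⊗[ℂ] B →ₗ[ℂ] ℂ,
        (∀ x, HasDerivAt (fun t : ℝ => Coalgebra.counit (R := ℂ) (μ t x)) (L x) 0) ∧
        FormCompatible β L ∧
        (∀ t : ℝ, ∃ E : B ⊗[ℂ] B →ₗ[ℂ] ℂ, IsFormExp β L t E ∧ μ t = mulConv β E) ∧
        convMul β L = mulConv β L ∧
        L (1 ⊗ₜ[ℂ] 1) = 0 ∧
        coboundary L = 0 ∧
        (∀ [StarRing B] [StarModule ℂ B], IsBraidedStarBialgebra β →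
          IsAdditiveStarDeformation β μ → HermitianForm L)) ∧
    (∀ L : B ⊗[ℂ] B →ₗ[ℂ] ℂ, FormCompatible β L →
      convMul β L = mulConv β L → L (1 ⊗ₜ[ℂ] 1) = 0 → coboundary L = 0 →
      ∃ E : ℝ → (B ⊗[ℂ] B →ₗ[ℂ] ℂ),
        (∀ t, IsFormExp β L t (E t)) ∧
        IsAdditiveDeformation β (fun t => mulConv β (E t)) ∧
        (∀ [StarRing B] [StarModule ℂ B], IsBraidedStarBialgebra β →
          HermitianForm L →
          IsAdditiveStarDeformation β (fun t => mulConv β (E t)))) := by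
  constructor
  · intro μ hμ
    have h₀ : Coalgebra.counit ∘ₗ μ 0 = tensorCounit B := by rw [hμ.zero, hB.counit_mul]
    obtain ⟨L, hL, hexp⟩ := hB.isCoalg_tensor.exists_generator
      (E := fun t => Coalgebra.counit ∘ₗ μ t) h₀ hμ.counit_comp_add
      (fun x => by rw [← h₀]; exact hμ.counit x)
    refine ⟨L, hL, hμ.formCompatible_deriv hB hL, fun t => ⟨_, hexp t, hμ.eq_mulConv t⟩,
      hμ.convMul_eq_mulConv hL, ?_, hμ.coboundary_eq_zero hB hL,
      fun hS hstar => hstar.hermitianForm_deriv hS hL⟩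
    refine (hL _).unique ((hasDerivAt_const (0 : ℝ) (1 : ℂ)).congr_of_eventuallyEq
      (Eventually.of_forall fun t => ?_))
    exact (congrArg _ ((hμ.algebra t).one_mul 1)).trans hB.counit_one
  · intro L hL hcomm h₁ hcob
    choose E hE using fun t : ℝ => hB.isCoalg_tensor.exists_isConvExp ((t : ℂ) • L)
    have hd := hB.isAdditiveDeformation_mulConv hL hcomm h₁ hcob hE
    exact ⟨E, hE, hd, fun hS hh => hS.isAdditiveStarDeformation hL hh hE hd⟩
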